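/- Let $n\ge 2$, let $p>1$ be a real number that is not an even integer, and let $f\in L^\infty(S^{n-1})$ (with respect to the spherical Lebesgue measure $d\xi$) satisfy $f\ge 0$ almost everywhere and not $f=0$ almost everywhere; for instance, $f$ may be any positive bounded measurable function. Let $H:\mathbb R^n\to[0,\infty)$ be the function with $$H(x)^p=\int_{S^{n-1}}|\langle x,\xi\rangle|^p f(\xi)\,d\xi\qquad(x\in\mathbb R^n).$$ Then $H$ is the support function of a convex body $K\subset\mathbb R^n$ with $K=-K$, and $K$ is of class $C^2_+$: it has non-empty interior, its boundary is a $C^2$ hypersurface, and the Gauss–Kronecker curvature of the boundary (the determinant of the differential of the outer unit normal map on the tangent hyperplane) is positive at every boundary point. Moreover $H$ is of class $C^2$ on $\mathbb R^n\setminus\{0\}$, and all principal radii of curvature of $K$, that is, the eigenvalues of $d(\nabla H)_u$ restricted to $u^\perp$ for unit vectors $u$, are positive. -/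

import Mathlib

open MeasureTheory Topology

noncomputable section

namespace LpCosine

/-- The Euclidean space `ℝⁿ`. -/
abbrev Eucl (n : ℕ) : Type := EuclideanSpace ℝ (Fin n)

/-- The unit sphere `S^{n-1}` of `ℝⁿ`. -/
abbrev Sph (n : ℕ) : Type := Metric.sphere (0 : Eucl n) 1

/-- The spherical Lebesgue measure on `S^{n-1}`, of total mass `n * vol(unit ball)`. -/
def sphereMeasure (n : ℕ) : Measure (Sph n) := (volume : Measure (Eucl n)).toSphere

/-- The `L^p`-cosine transform `x ↦ ∫ |⟨x, ξ⟩|^p f(ξ) dξ` over the unit sphere. -/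
def cosineTransform {n : ℕ} (p : ℝ) (f : Sph n → ℝ) (x : Eucl n) : ℝ :=
  ∫ ξ : Sph n, |inner ℝ x (ξ : Eucl n)| ^ p * f ξ ∂(sphereMeasure n)

/-- `H` is the support function of `K`: `H x = sup {⟨x, y⟩ : y ∈ K}` for every `x`. -/
def IsSupportFunction {n : ℕ} (H : Eucl n → ℝ) (K : ConvexBody (Eucl n)) : Prop :=
  ∀ x : Eucl n, IsLUB ((fun y : Eucl n => inner ℝ x y) '' (K : Set (Eucl n))) (H x)

/-- The endomorphism of the hyperplane `u^⊥` induced by a linear map `A` of `ℝⁿ`. It is used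
below only for maps `A` which send `u^⊥` into itself; the projection then acts as the identity. -/
def tangentCompression {n : ℕ} (u : Eucl n) (A : Eucl n →L[ℝ] Eucl n) :
    (ℝ ∙ u)ᗮ →L[ℝ] (ℝ ∙ u)ᗮ :=
  (ℝ ∙ u)ᗮ.orthogonalProjectionOnto ∘L A ∘L (ℝ ∙ u)ᗮ.subtypeL

/-- `g` is a `C²` local defining function of the set `K` near `x`: its gradient does not vanish at
`x`, and `K` coincides with `{g ≤ 0}` near `x`. A convex body with interior points has `C²`
boundary iff it has such a function at each of its boundary points; near `x` the boundary is then the regular level set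
`{g = 0}`, with outer normal direction `∇ g`. -/
structure IsLocalDefiningFunction {n : ℕ} (K : Set (Eucl n)) (g : Eucl n → ℝ) (x : Eucl n) :
    Prop where
  contDiffAt : ContDiffAt ℝ 2 g x
  gradient_ne_zero : gradient g x ≠ 0
  mem_iff : ∀ᶠ y in 𝓝 x, y ∈ K ↔ g y ≤ 0

/-- The outer unit normal field (Gauss map) `∇ g / ‖∇ g‖` of the level sets of `g`. -/
def unitNormal {n : ℕ} (g : Eucl n → ℝ) (y : Eucl n) : Eucl n :=
  ‖gradient g y‖⁻¹ • gradient g y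

/-- The Weingarten map at `x` of the level set of `g` through `x`: the differential of the Gauss
map on the tangent hyperplane `(∇ g x)^⊥`. -/
def weingartenMap {n : ℕ} (g : Eucl n → ℝ) (x : Eucl n) :
    (ℝ ∙ unitNormal g x)ᗮ →L[ℝ] (ℝ ∙ unitNormal g x)ᗮ :=
  tangentCompression (unitNormal g x) (fderiv ℝ (unitNormal g) x)

/-- The Gauss–Kronecker curvature at `x` of the level set of `g` through `x`: the determinant of
the Weingarten map, i.e. the product of the principal curvatures with respect to the outer normal
(positive on round spheres). -/
def gaussKronecker {n : ℕ} (g : Eucl n → ℝ) (x : Eucl n) : ℝ :=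
  LinearMap.det (weingartenMap g x : (ℝ ∙ unitNormal g x)ᗮ →ₗ[ℝ] (ℝ ∙ unitNormal g x)ᗮ)

/-- The convex body `K` is of class `C²₊`: it has interior points, its boundary is a `C²`
hypersurface, and the Gauss–Kronecker curvature of the boundary is positive at every boundary
point. (The Gauss map of the boundary, and hence its curvature, does not depend on the choice of
the local defining function.) -/
def IsC2Plus {n : ℕ} (K : ConvexBody (Eucl n)) : Prop :=
  (interior (K : Set (Eucl n))).Nonempty ∧
    ∀ x ∈ frontier (K : Set (Eucl n)), ∃ g : Eucl n → ℝ,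
      IsLocalDefiningFunction (K : Set (Eucl n)) g x ∧ 0 < gaussKronecker g x

/-- The reverse Weingarten map at the unit vector `u` of a convex body with support function `H`:
the differential `d(∇ H)_u` on the tangent space `u^⊥` of the sphere. -/
def reverseWeingartenMap {n : ℕ} (H : Eucl n → ℝ) (u : Eucl n) :
    (ℝ ∙ u)ᗮ →L[ℝ] (ℝ ∙ u)ᗮ :=
  tangentCompression u (fderiv ℝ (gradient H) u)

/-- `r` is a principal radius of curvature, at the outer unit normal `u`, of the convex body with
support function `H`: an eigenvalue of the reverse Weingarten map. -/
def IsPrincipalRadius {n : ℕ} (H : Eucl n → ℝ) (u : Eucl n) (r : ℝ) : Prop :=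
  Module.End.HasEigenvalue (reverseWeingartenMap H u : (ℝ ∙ u)ᗮ →ₗ[ℝ] (ℝ ∙ u)ᗮ) r

end LpCosine

end

/-!
Write `dμ = f dξ`, a nonzero measure dominated by a multiple of the spherical measure, and
`Φ x = ∫ |⟨x, ξ⟩|^p dμ`, so that `H = Φ^{1/p}`.

*Regularity.* One always has `∇Φ = p G` with `G x = ∫ |⟨x, ξ⟩|^{p-1} sign ⟨x, ξ⟩ ξ dμ`, and formally
`dG_x = (p - 1) ∫ |⟨x, ξ⟩|^{p-2} ξ ⊗ ξ dμ`. When `p < 2` this kernel is singular along the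
great sphere orthogonal to `x`, but `p - 2 > -1` makes it integrable. It dominates, up to a
factor `2`, the difference quotients of `G` based at `x`, which gives differentiability of `G` at
every `x ≠ 0` (`hasFDerivAt_cosineField`). For the continuity of `dG` the singularity moves with
`x`, and no single dominating function exists; instead rotation invariance gives
`∫ |⟨x, ξ⟩|^s dξ = ‖x‖^s c_s`, and almost everywhere convergence together with convergence of the
`L¹` norms implies convergence in `L¹` (`tendsto_integral_abs_inner_rpow_sub`). The boundedness of
`f` carries this over to `μ`.

*Convexity and curvature.* Hölder's inequality is the tangent plane inequality `⟨∇H x, z⟩ ≤ H z`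
(`inner_cosineField_le`). The Hessian of `H` at `x` is, up to a positive factor, the defect in the
Cauchy–Schwarz inequality for `⟨x, ξ⟩` and `⟨v, ξ⟩` in `L²(|⟨x, ξ⟩|^{p-2} dμ)`. Equality would force
`⟨v - c x, ξ⟩ = 0` for `μ`-almost every `ξ`, while central hyperplanes are `μ`-null; so the Hessian
is positive definite transversally to `x` (`inner_cosineField_sq_lt`). These facts about `H` are
collected in `IsC2PlusNorm`.

*The body.* From here on only `IsC2PlusNorm` is used. The body is `K = {y | ∀ x, ⟨x, y⟩ ≤ H x}`,
and each of its boundary points is `∇H z` for some `z` with `H z = 1`. The Hessian of `H² / 2` is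
positive definite, so `∇(H² / 2) = H ∇H` has a local `C¹` inverse `ψ`. The Legendre transform
`y ↦ ⟨y, ψ y⟩ - H (ψ y)² / 2`, whose gradient is `ψ`, equals `1 / 2` exactly on the boundary of `K`,
and is therefore a `C²` defining function up to a constant. Its Gauss map is `ψ / ‖ψ‖`; up to the
factor `‖ψ‖⁻¹`, the Weingarten map is the compression of the inverse of a positive definite
operator, and has positive determinant
(`IsC2PlusNorm.exists_isLocalDefiningFunction`).
-/

noncomputable section

namespace LpCosine

open Filter Set ENNReal NNReal

/-! ### Powers of linear functionals on the sphere -/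

/-- Integration over the sphere as an integral over the unit ball of the extension that is
constant along rays. -/
theorem lintegral_sphereMeasure {n : ℕ} (hn : n ≠ 0) {W : Eucl n → ℝ≥0∞} (hW : Measurable W) :
    ∫⁻ ξ : Sph n, W ξ ∂(sphereMeasure n) =
      n * ∫⁻ y in Metric.ball (0 : Eucl n) 1, W (‖y‖⁻¹ • y) := by
  have : NeZero n := ⟨hn⟩
  have hmp := (volume : Measure (Eucl n)).measurePreserving_homeomorphUnitSphereProd
  let A : Set (Ioi (0 : ℝ)) := Iio ⟨1, mem_Ioi.2 one_pos⟩
  have hA : MeasurableSet A := measurableSet_Iio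
  have h1 := hmp.lintegral_comp
    (f := fun q : Sph n × Ioi (0 : ℝ) => W q.1 * A.indicator 1 q.2)
    ((hW.comp (measurable_subtype_coe.comp measurable_fst)).mul
      ((measurable_one.indicator hA).comp measurable_snd))
  rw [lintegral_prod_mul (f := fun ξ : Sph n => W ξ) (hW.comp measurable_subtype_coe).aemeasurable
    (measurable_one.indicator hA).aemeasurable] at h1
  have hvol : ∫⁻ r, A.indicator 1 r ∂(Measure.volumeIoiPow (Module.finrank ℝ (Eucl n) - 1)) =
      (n : ℝ≥0∞)⁻¹ := by
    rw [lintegral_indicator_one hA, Measure.volumeIoiPow_apply_Iio]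
    have h2 : n - 1 + 1 = n := Nat.succ_pred hn
    have h3 : ((n - 1 : ℕ) : ℝ) + 1 = n := by exact_mod_cast h2
    simp only [finrank_euclideanSpace, Fintype.card_fin, one_pow, h3, one_div]
    rw [ENNReal.ofReal_inv_of_pos (by positivity), ENNReal.ofReal_natCast]
  rw [hvol] at h1
  have h4 : ∫⁻ y : ({0}ᶜ : Set (Eucl n)), W ((homeomorphUnitSphereProd (Eucl n) y).1) *
        A.indicator 1 (homeomorphUnitSphereProd (Eucl n) y).2 ∂(Measure.comap Subtype.val volume) =
      ∫⁻ y in Metric.ball (0 : Eucl n) 1, W (‖y‖⁻¹ • y) := by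
    rw [← lintegral_indicator Metric.isOpen_ball.measurableSet]
    have h5 := lintegral_subtype_comap (μ := (volume : Measure (Eucl n)))
      (measurableSet_singleton (0 : Eucl n)).compl
      (fun y => (Metric.ball (0 : Eucl n) 1).indicator (fun y => W (‖y‖⁻¹ • y)) y)
    rw [restrict_compl_singleton] at h5
    rw [← h5]
    refine lintegral_congr fun y => ?_
    by_cases hy : ‖(y : Eucl n)‖ < 1
    · have : (homeomorphUnitSphereProd (Eucl n) y).2 ∈ A := by
        rw [mem_Iio, ← Subtype.coe_lt_coe]; simpa using hy
      simp [this, hy]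
    · have : (homeomorphUnitSphereProd (Eucl n) y).2 ∉ A := by
        rw [mem_Iio, ← Subtype.coe_lt_coe]; simpa using hy
      simp [this, hy]
  rw [h4] at h1
  rw [h1, mul_comm, mul_assoc]
  rw [ENNReal.inv_mul_cancel (by exact_mod_cast hn) (by simp), mul_one]
  rfl

/-- A central hyperplane meets the sphere in a null set. -/
theorem ae_inner_ne_zero {n : ℕ} {x : Eucl n} (hx : x ≠ 0) :
    ∀ᵐ ξ : Sph n ∂(sphereMeasure n), inner ℝ x (ξ : Eucl n) ≠ 0 := by
  have hn : n ≠ 0 := by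
    rintro rfl; exact hx (Subsingleton.elim _ _)
  have hm : MeasurableSet {y : Eucl n | inner ℝ x y = 0} :=
    (isClosed_eq (by fun_prop) continuous_const).measurableSet
  have h := lintegral_sphereMeasure hn (measurable_one.indicator hm)
  have h0 : volume {y : Eucl n | inner ℝ x y = 0} = 0 := by
    have := Measure.addHaar_submodule (volume : Measure (Eucl n)) (ℝ ∙ x)ᗮ (by
      intro h
      have : x ∈ (ℝ ∙ x)ᗮ := by rw [h]; trivial
      rw [Submodule.mem_orthogonal_singleton_iff_inner_right] at this
      exact hx (inner_self_eq_zero.1 this))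
    refine measure_mono_null ?_ this
    intro y hy
    exact Submodule.mem_orthogonal_singleton_iff_inner_right.2 hy
  have h1 : ∫⁻ y in Metric.ball (0 : Eucl n) 1,
      ({y : Eucl n | inner ℝ x y = 0}.indicator 1 (‖y‖⁻¹ • y) : ℝ≥0∞) = 0 := by
    refine le_antisymm ((setLIntegral_le_lintegral _ _).trans ?_) zero_le
    rw [← h0, ← lintegral_indicator_one hm]
    have hne : ∀ᵐ y : Eucl n, y ≠ 0 := by
      have : NeZero n := ⟨hn⟩
      exact compl_mem_ae_iff.2 (measure_singleton _)
    refine (lintegral_congr_ae ?_).le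
    filter_upwards [hne] with y hy
    simp [indicator, inner_smul_right, hy]
  rw [h1, mul_zero] at h
  have h2 : MeasurableSet {ξ : Sph n | inner ℝ x (ξ : Eucl n) = 0} :=
    measurable_subtype_coe hm
  rw [ae_iff]
  simp only [not_not, ne_eq]
  rw [← lintegral_indicator_one h2]
  exact h

/-- The spherical integral of a function of `⟨x, ξ⟩` depends on `x` only through `‖x‖`. -/
theorem lintegral_inner_eq_of_norm_eq {n : ℕ} {g : ℝ → ℝ≥0∞} (hg : Measurable g)
    {x y : Eucl n} (hxy : ‖x‖ = ‖y‖) :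
    ∫⁻ ξ : Sph n, g (inner ℝ x (ξ : Eucl n)) ∂(sphereMeasure n) =
      ∫⁻ ξ : Sph n, g (inner ℝ y (ξ : Eucl n)) ∂(sphereMeasure n) := by
  rcases eq_or_ne n 0 with rfl | hn
  · rw [Subsingleton.elim x y]
  have hm : ∀ z : Eucl n, Measurable fun w : Eucl n => g (inner ℝ z w) := fun z =>
    hg.comp (by fun_prop)
  rw [lintegral_sphereMeasure hn (hm x), lintegral_sphereMeasure hn (hm y)]
  congr 1
  let R : Eucl n ≃ₗᵢ[ℝ] Eucl n := (ℝ ∙ (x - y))ᗮ.reflection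
  have hR : R x = y := Submodule.reflection_sub hxy
  have hball : R ⁻¹' Metric.ball (0 : Eucl n) 1 = Metric.ball 0 1 := by
    ext z; simp
  rw [← R.measurePreserving.setLIntegral_comp_preimage Metric.isOpen_ball.measurableSet
    (f := fun z => g (inner ℝ y (‖z‖⁻¹ • z))) ((hm y).comp (by fun_prop)), hball]
  refine lintegral_congr fun z => ?_
  simp only [LinearIsometryEquiv.norm_map, ← map_smul, ← hR, LinearIsometryEquiv.inner_map_map]

/-- Integrability of `|y₀|^s` over the unit ball, by comparison with the cube. -/
theorem lintegral_ball_coord_rpow_lt_top {n : ℕ} (i : Fin n) {s : ℝ} (hs : -1 < s) :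
    ∫⁻ y in Metric.ball (0 : Eucl n) 1, ENNReal.ofReal (|y i| ^ s) < ∞ := by
  classical
  let k : Fin n → ℝ → ℝ := fun j t =>
    (Icc (-1 : ℝ) 1).indicator (fun t => if j = i then |t| ^ s else 1) t
  have hint : IntegrableOn (fun t : ℝ => |t| ^ s) (Icc (-1 : ℝ) 1) := by
    have h01 : IntegrableOn (fun t : ℝ => |t| ^ s) (Ioc 0 1) := by
      have h := (intervalIntegral.intervalIntegrable_rpow' (a := 0) (b := 1) hs).1
      refine h.congr_fun (fun t ht => ?_) measurableSet_Ioc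
      simp only [abs_of_pos ht.1]
    have h10 : IntegrableOn (fun t : ℝ => |t| ^ s) (Ico (-1) 0) := by
      have h := (integrable_indicator_iff measurableSet_Ioc).2 h01
      have h' := h.comp_neg
      refine (integrable_indicator_iff measurableSet_Ico).1 (h'.congr (ae_of_all _ fun t => ?_))
      simp only [indicator, mem_Ioc, mem_Ico, abs_neg]
      congr 1
      simp only [eq_iff_iff]
      constructor <;> rintro ⟨h1, h2⟩ <;> constructor <;> linarith
    refine ((h10.union (integrableOn_singleton (x := (0 : ℝ)) (by simp) (by simp))).union
      h01).mono_set ?_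
    intro t ht
    rcases lt_trichotomy t 0 with h | h | h
    · exact .inl (.inl ⟨ht.1, h⟩)
    · exact .inl (.inr h)
    · exact .inr ⟨h, ht.2⟩
  have hk : ∀ j, Integrable (k j) := by
    intro j
    refine (integrable_indicator_iff measurableSet_Icc).2 ?_
    by_cases hj : j = i
    · simpa [hj] using hint
    · simp [hj]
  have hprod : Integrable (fun y : Fin n → ℝ => ∏ j, k j (y j)) := Integrable.fintype_prod hk
  have hE : Integrable (fun y : Eucl n => ∏ j, k j (y j)) :=
    ((EuclideanSpace.volume_preserving_symm_measurableEquiv_toLp (Fin n)).integrable_comp_emb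
      (MeasurableEquiv.measurableEmbedding _)).2 hprod
  refine lt_of_le_of_lt ?_ hE.lintegral_lt_top
  rw [← lintegral_indicator Metric.isOpen_ball.measurableSet]
  refine lintegral_mono fun y => ?_
  by_cases hy : y ∈ Metric.ball (0 : Eucl n) 1
  · have hy' : ∀ j, y j ∈ Icc (-1 : ℝ) 1 := fun j => by
      have h1 := PiLp.norm_apply_le y j
      have h2 : ‖y‖ < 1 := by simpa using hy
      exact abs_le.1 (h1.trans h2.le)
    have : ∏ j, k j (y j) = |y i| ^ s := by
      rw [Finset.prod_eq_single i]
      · simp [k, indicator_of_mem (hy' i)]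
      · intro j _ hj
        simp [k, indicator_of_mem (hy' j), hj]
      · simp
    rw [indicator_of_mem hy, this]
  · rw [indicator_of_notMem hy]; exact zero_le

theorem inner_le_norm_sph {n : ℕ} (x : Eucl n) (ξ : Sph n) :
    |inner ℝ x (ξ : Eucl n)| ≤ ‖x‖ := by
  simpa using abs_real_inner_le_norm x (ξ : Eucl n)

/-- For `s > -1` the function `|⟨x, ξ⟩|^s` has a finite integral over the sphere. -/
theorem lintegral_inner_rpow_lt_top {n : ℕ} {s : ℝ} (hs : -1 < s) {x : Eucl n} (hx : x ≠ 0) :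
    ∫⁻ ξ : Sph n, ENNReal.ofReal (|inner ℝ x (ξ : Eucl n)| ^ s) ∂(sphereMeasure n) < ∞ := by
  have hfin : IsFiniteMeasure (sphereMeasure n) := by unfold sphereMeasure; infer_instance
  rcases le_or_gt 0 s with h0 | h0
  · refine lt_of_le_of_lt (lintegral_mono fun ξ => ENNReal.ofReal_le_ofReal
      (Real.rpow_le_rpow (abs_nonneg _) (inner_le_norm_sph x ξ) h0)) ?_
    rw [lintegral_const]
    exact ENNReal.mul_lt_top ENNReal.ofReal_lt_top (measure_lt_top _ _)
  have hn : n ≠ 0 := by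
    rintro rfl; exact hx (Subsingleton.elim _ _)
  let i : Fin n := ⟨0, Nat.pos_of_ne_zero hn⟩
  let e : Eucl n := EuclideanSpace.single i ‖x‖
  have he : ‖x‖ = ‖e‖ := by simp [e]
  have hg : Measurable fun t : ℝ => ENNReal.ofReal (|t| ^ s) := by fun_prop
  rw [lintegral_inner_eq_of_norm_eq hg he,
    lintegral_sphereMeasure hn (W := fun w => ENNReal.ofReal (|inner ℝ e w| ^ s))
      (hg.comp (by fun_prop))]
  refine ENNReal.mul_lt_top (ENNReal.natCast_lt_top _) ?_
  have hle : ∀ y ∈ Metric.ball (0 : Eucl n) 1,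
      ENNReal.ofReal (|inner ℝ e (‖y‖⁻¹ • y)| ^ s) ≤
        ENNReal.ofReal (‖x‖ ^ s) * ENNReal.ofReal (|y i| ^ s) := by
    intro y hy
    have hy1 : ‖y‖ < 1 := by simpa using hy
    rw [← ENNReal.ofReal_mul (by positivity)]
    refine ENNReal.ofReal_le_ofReal ?_
    have h1 : inner ℝ e (‖y‖⁻¹ • y) = ‖y‖⁻¹ * (‖x‖ * y i) := by
      simp [e, inner_smul_right, EuclideanSpace.inner_single_left]
    rw [h1, abs_mul, abs_mul, Real.mul_rpow (by positivity) (by positivity),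
      Real.mul_rpow (by positivity) (by positivity), abs_of_nonneg (norm_nonneg x)]
    -- As `s < 0`, the radial factor `‖y‖^{-s}` is at most `1` on the unit ball.
    have h2 : |‖y‖⁻¹| ^ s ≤ 1 := by
      rw [abs_of_nonneg (by positivity), Real.inv_rpow (norm_nonneg _),
        ← Real.rpow_neg (norm_nonneg _)]
      exact Real.rpow_le_one (norm_nonneg _) hy1.le (by linarith)
    exact mul_le_of_le_one_left (by positivity) h2
  refine lt_of_le_of_lt (setLIntegral_mono' Metric.isOpen_ball.measurableSet hle) ?_
  rw [lintegral_const_mul _ (by fun_prop)]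
  exact ENNReal.mul_lt_top ENNReal.ofReal_lt_top (lintegral_ball_coord_rpow_lt_top i hs)

/-- The integral of `|⟨x, ξ⟩|^s` over the sphere is homogeneous of degree `s` in `‖x‖`. -/
theorem lintegral_inner_rpow_eq {n : ℕ} {s : ℝ} {x y : Eucl n} (hx : x ≠ 0) (hy : y ≠ 0) :
    ∫⁻ ξ : Sph n, ENNReal.ofReal (|inner ℝ y (ξ : Eucl n)| ^ s) ∂(sphereMeasure n) =
      ENNReal.ofReal ((‖y‖ / ‖x‖) ^ s) *
      ∫⁻ ξ : Sph n, ENNReal.ofReal (|inner ℝ x (ξ : Eucl n)| ^ s) ∂(sphereMeasure n) := by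
  have hg : Measurable fun t : ℝ => ENNReal.ofReal (|t| ^ s) := by fun_prop
  have hx' := norm_pos_iff.2 hx
  have he : ‖y‖ = ‖(‖y‖ / ‖x‖) • x‖ := by
    rw [norm_smul, Real.norm_of_nonneg (by positivity), div_mul_cancel₀ _ hx'.ne']
  rw [lintegral_inner_eq_of_norm_eq hg he, ← lintegral_const_mul _ (by fun_prop)]
  refine lintegral_congr fun ξ => ?_
  rw [real_inner_smul_left, abs_mul, Real.mul_rpow (by positivity) (by positivity),
    abs_of_nonneg (by positivity), ENNReal.ofReal_mul (by positivity)]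

theorem integrable_inner_rpow {n : ℕ} {s : ℝ} (hs : -1 < s) {x : Eucl n} (hx : x ≠ 0) :
    Integrable (fun ξ : Sph n => |inner ℝ x (ξ : Eucl n)| ^ s) (sphereMeasure n) := by
  refine ⟨(by fun_prop : Measurable _).aestronglyMeasurable, ?_⟩
  rw [hasFiniteIntegral_iff_ofReal (ae_of_all _ fun ξ => by positivity)]
  exact lintegral_inner_rpow_lt_top hs hx

/-- `x ↦ |⟨x, ·⟩|^s` is continuous away from the origin as a map to `L¹` of the sphere. Since the
`L¹` norms depend continuously on `x`, it suffices to apply dominated convergence to the minimum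
of two such functions. -/
theorem tendsto_integral_abs_inner_rpow_sub {n : ℕ} {s : ℝ} (hs : -1 < s) {x : Eucl n}
    (hx : x ≠ 0) :
    Tendsto (fun y : Eucl n => ∫ ξ : Sph n,
      |(|inner ℝ y (ξ : Eucl n)| ^ s - |inner ℝ x (ξ : Eucl n)| ^ s)| ∂(sphereMeasure n))
      (𝓝 x) (𝓝 0) := by
  set k : Eucl n → Sph n → ℝ := fun y ξ => |inner ℝ y (ξ : Eucl n)| ^ s with hk
  have hne : ∀ᶠ y in 𝓝 x, y ≠ 0 := isOpen_ne.mem_nhds hx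
  have hnorm : Tendsto (fun y => ∫ ξ, k y ξ ∂(sphereMeasure n)) (𝓝 x)
      (𝓝 (∫ ξ, k x ξ ∂(sphereMeasure n))) := by
    have h1 : ∀ᶠ y in 𝓝 x, (‖y‖ / ‖x‖) ^ s * ∫ ξ, k x ξ ∂(sphereMeasure n) =
        ∫ ξ, k y ξ ∂(sphereMeasure n) := by
      filter_upwards [hne] with y hy
      rw [integral_eq_lintegral_of_nonneg_ae (f := k y) (ae_of_all _ fun ξ => by positivity)
          (by fun_prop : Measurable (k y)).aestronglyMeasurable,
        integral_eq_lintegral_of_nonneg_ae (f := k x) (ae_of_all _ fun ξ => by positivity)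
          (by fun_prop : Measurable (k x)).aestronglyMeasurable,
        lintegral_inner_rpow_eq hx hy, ENNReal.toReal_mul, ENNReal.toReal_ofReal (by positivity)]
    have hx' : ‖x‖ ≠ 0 := norm_ne_zero_iff.2 hx
    have h2 : Tendsto (fun y => (‖y‖ / ‖x‖) ^ s * ∫ ξ, k x ξ ∂(sphereMeasure n)) (𝓝 x)
        (𝓝 ((‖x‖ / ‖x‖) ^ s * ∫ ξ, k x ξ ∂(sphereMeasure n))) := by
      refine Tendsto.mul_const _ (Tendsto.rpow_const ?_ (.inl (by simp [hx])))
      exact (continuous_norm.div_const _).tendsto x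
    rw [div_self hx', Real.one_rpow, one_mul] at h2
    exact h2.congr' h1
  have hmin : Tendsto (fun y => ∫ ξ, min (k y ξ) (k x ξ) ∂(sphereMeasure n)) (𝓝 x)
      (𝓝 (∫ ξ, k x ξ ∂(sphereMeasure n))) := by
    refine tendsto_integral_filter_of_dominated_convergence (k x) ?_ ?_
      (integrable_inner_rpow hs hx) ?_
    · exact .of_forall fun y => (by fun_prop : Measurable _).aestronglyMeasurable
    · refine .of_forall fun y => ae_of_all _ fun ξ => ?_
      rw [Real.norm_of_nonneg (by positivity)]
      exact min_le_right _ _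
    · filter_upwards [ae_inner_ne_zero hx] with ξ hξ
      have h1 : Tendsto (fun y => k y ξ) (𝓝 x) (𝓝 (k x ξ)) := by
        refine Tendsto.rpow_const ?_ (.inl (abs_ne_zero.2 hξ))
        exact (by fun_prop : Continuous fun y : Eucl n => |inner ℝ y (ξ : Eucl n)|).tendsto x
      simpa using h1.min (tendsto_const_nhds (x := k x ξ))
  -- `|a - b| = a + b - 2 min(a, b)`
  have h3 := (hnorm.add_const (∫ ξ, k x ξ ∂(sphereMeasure n))).sub (hmin.const_mul 2)
  have h4 : (∫ ξ, k x ξ ∂(sphereMeasure n)) + (∫ ξ, k x ξ ∂(sphereMeasure n)) -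
      2 * ∫ ξ, k x ξ ∂(sphereMeasure n) = 0 := by ring
  rw [h4] at h3
  refine h3.congr' ?_
  filter_upwards [hne] with y hy
  have iy : Integrable (k y) (sphereMeasure n) := integrable_inner_rpow hs hy
  have ix : Integrable (k x) (sphereMeasure n) := integrable_inner_rpow hs hx
  rw [← integral_add iy ix, ← integral_const_mul,
    ← integral_sub (f := fun ξ => k y ξ + k x ξ) (g := fun ξ => 2 * min (k y ξ) (k x ξ))
      (iy.add ix) ((iy.inf ix).const_mul 2)]
  refine integral_congr_ae (ae_of_all _ fun ξ => ?_)
  change k y ξ + k x ξ - 2 * min (k y ξ) (k x ξ) = |k y ξ - k x ξ|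
  rcases le_total (k y ξ) (k x ξ) with h | h
  · rw [min_eq_left h, abs_of_nonpos (by linarith)]; ring
  · rw [min_eq_right h, abs_of_nonneg (by linarith)]; ring

/-! ### The odd power function -/

/-- The odd power function `t ↦ |t|^{p-1} sign t`, which is `1 / p` times the derivative of
`|t|^p`. -/
def oddPow (p t : ℝ) : ℝ := |t| ^ (p - 2) * t

@[fun_prop]
theorem measurable_oddPow (p : ℝ) : Measurable (oddPow p) := by
  unfold oddPow; fun_prop

theorem oddPow_mul_self {p : ℝ} (hp : 1 < p) (t : ℝ) : oddPow p t * t = |t| ^ p := by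
  rcases eq_or_ne t 0 with rfl | ht
  · simp [oddPow, Real.zero_rpow (by linarith : p ≠ 0)]
  · rw [oddPow, mul_assoc, ← abs_mul_abs_self t, ← mul_assoc,
      ← Real.rpow_add_one (abs_ne_zero.2 ht),
      ← Real.rpow_add_one (abs_ne_zero.2 ht)]
    congr 1; ring

theorem abs_oddPow {p : ℝ} (hp : 1 < p) (t : ℝ) : |oddPow p t| = |t| ^ (p - 1) := by
  rcases eq_or_ne t 0 with rfl | ht
  · simp [oddPow, Real.zero_rpow (by linarith : p - 1 ≠ 0)]
  · rw [oddPow, abs_mul, abs_of_nonneg (a := |t| ^ (p - 2)) (by positivity),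
      ← Real.rpow_add_one (abs_ne_zero.2 ht)]
    congr 1; ring

theorem oddPow_mul {p : ℝ} (s a : ℝ) : oddPow p (s * a) = oddPow p s * oddPow p a := by
  simp only [oddPow, abs_mul, Real.mul_rpow (abs_nonneg s) (abs_nonneg a)]; ring

theorem hasDerivAt_oddPow (p : ℝ) {t : ℝ} (ht : t ≠ 0) :
    HasDerivAt (oddPow p) ((p - 1) * |t| ^ (p - 2)) t := by
  have h1 : HasDerivAt (fun t : ℝ => |t| ^ (p - 2))
      ((SignType.sign t : ℝ) * (p - 2) * |t| ^ (p - 2 - 1)) t :=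
    (hasDerivAt_abs ht).rpow_const (.inl (abs_ne_zero.2 ht))
  refine (h1.mul (hasDerivAt_id t)).congr_deriv ?_
  have h2 : |t| ^ (p - 2) = |t| ^ (p - 2 - 1) * |t| := by
    rw [← Real.rpow_add_one (abs_ne_zero.2 ht)]; congr 1; ring
  rw [h2]
  have h3 : (SignType.sign t : ℝ) * t = |t| := sign_mul_self t
  simp only [id, ← h3]
  ring

theorem hasDerivAt_oddPow_of_two_le {p : ℝ} (hp : 2 ≤ p) (t : ℝ) :
    HasDerivAt (oddPow p) ((p - 1) * |t| ^ (p - 2)) t := by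
  rcases eq_or_ne t 0 with rfl | ht
  swap
  · exact hasDerivAt_oddPow p ht
  rcases hp.eq_or_lt with rfl | hp
  · have : oddPow 2 = id := by ext t; simp [oddPow]
    rw [this]
    exact (hasDerivAt_id (0 : ℝ)).congr_deriv (by norm_num)
  · rw [hasDerivAt_iff_tendsto_slope_zero]
    have h1 : Tendsto (fun t : ℝ => |t| ^ (p - 2)) (𝓝[≠] 0) (𝓝 (|0| ^ (p - 2))) :=
      ((continuous_abs.tendsto (0 : ℝ)).rpow_const (.inr (by linarith))).mono_left
        nhdsWithin_le_nhds
    have h2 : (p - 1) * |(0 : ℝ)| ^ (p - 2) = |0| ^ (p - 2) := by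
      simp [Real.zero_rpow (by linarith : p - 2 ≠ 0)]
    rw [h2]
    refine h1.congr' ?_
    filter_upwards [self_mem_nhdsWithin] with t ht
    have ht : t ≠ 0 := ht
    simp only [oddPow, zero_add, mul_zero, sub_zero, smul_eq_mul]
    field_simp

/-- For `1 < p < 2` the odd power has a Lipschitz bound based at `a` whose constant is comparable
to its derivative at `a`, in spite of the infinite slope at the origin. -/
theorem abs_oddPow_sub_le_of_lt_two {p : ℝ} (hp : 1 < p) (hp2 : p < 2) {a : ℝ} (ha : a ≠ 0)
    (b : ℝ) : |oddPow p b - oddPow p a| ≤ 2 * |a| ^ (p - 2) * |b - a| := by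
  obtain ⟨s, rfl⟩ : ∃ s, b = s * a := ⟨b / a, by field_simp⟩
  have key : |oddPow p s - 1| ≤ 2 * |s - 1| := by
    rcases lt_trichotomy s 0 with hs | rfl | hs
    · have h1 : |s| ^ (p - 1) ≤ 1 + |s| := by
        rcases le_total |s| 1 with h | h
        · have := Real.rpow_le_one (abs_nonneg s) h (by linarith : 0 ≤ p - 1)
          linarith [abs_nonneg s]
        · have := Real.rpow_le_rpow_of_exponent_le h (by linarith : p - 1 ≤ 1)
          rw [Real.rpow_one] at this; linarith
      calc |oddPow p s - 1| ≤ |oddPow p s| + |1| := abs_sub _ _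
        _ ≤ 2 * |s - 1| := by
          rw [abs_oddPow hp, abs_one, abs_of_neg (by linarith : s - 1 < 0)]
          rw [abs_of_neg hs] at h1 ⊢
          linarith
    · simp [oddPow]
    · have h0 : oddPow p s = s ^ (p - 1) := by
        rw [oddPow, abs_of_pos hs, ← Real.rpow_add_one hs.ne']; congr 1; ring
      rw [h0]
      rcases le_total s 1 with h | h
      · have h1 := Real.rpow_le_one hs.le h (by linarith : 0 ≤ p - 1)
        have h2 := Real.rpow_le_rpow_of_exponent_ge hs h (by linarith : p - 1 ≤ 1)
        rw [Real.rpow_one] at h2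
        rw [abs_of_nonpos (by linarith), abs_of_nonpos (by linarith)]
        linarith
      · have h1 := Real.one_le_rpow h (by linarith : 0 ≤ p - 1)
        have h2 := Real.rpow_le_rpow_of_exponent_le h (by linarith : p - 1 ≤ 1)
        rw [Real.rpow_one] at h2
        rw [abs_of_nonneg (by linarith), abs_of_nonneg (by linarith)]
        linarith
  have h1 : oddPow p (s * a) - oddPow p a = oddPow p a * (oddPow p s - 1) := by
    rw [oddPow_mul]; ring
  have h2 : s * a - a = (s - 1) * a := by ring
  have h3 : |oddPow p a| = |a| ^ (p - 2) * |a| := by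
    rw [oddPow, abs_mul, abs_of_nonneg (a := |a| ^ (p - 2)) (by positivity)]
  rw [h1, h2, abs_mul, abs_mul, h3]
  calc |a| ^ (p - 2) * |a| * |oddPow p s - 1| ≤ |a| ^ (p - 2) * |a| * (2 * |s - 1|) := by gcongr
    _ = _ := by ring

theorem abs_oddPow_sub_le_of_two_le {p : ℝ} (hp : 2 ≤ p) {R a b : ℝ} (ha : |a| ≤ R) (hb : |b| ≤ R) :
    |oddPow p b - oddPow p a| ≤ (p - 1) * R ^ (p - 2) * |b - a| := by
  refine Convex.norm_image_sub_le_of_norm_hasDerivWithin_le (s := Icc (-R) R)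
    (fun t _ => (hasDerivAt_oddPow_of_two_le hp t).hasDerivWithinAt) (fun t ht => ?_)
    (convex_Icc _ _) (abs_le.1 ha) (abs_le.1 hb)
  rw [Real.norm_of_nonneg (mul_nonneg (by linarith) (by positivity))]
  exact mul_le_mul_of_nonneg_left (Real.rpow_le_rpow (abs_nonneg _) (abs_le.2 ht) (by linarith))
    (by linarith)

/-! ### Differentiating the cosine transform of a measure -/

/-- The `L^p`-cosine transform of a measure on the sphere. -/
def cosinePotential {n : ℕ} (p : ℝ) (μ : Measure (Sph n)) (x : Eucl n) : ℝ :=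
  ∫ ξ : Sph n, |inner ℝ x (ξ : Eucl n)| ^ p ∂μ

/-- The vector field `∫ |⟨x, ξ⟩|^{p-1} sign ⟨x, ξ⟩ ξ dμ(ξ)`; `p` times it is the gradient of the
`L^p`-cosine transform of `μ`. -/
def cosineField {n : ℕ} (p : ℝ) (μ : Measure (Sph n)) (x : Eucl n) : Eucl n :=
  ∫ ξ : Sph n, oddPow p (inner ℝ x (ξ : Eucl n)) • (ξ : Eucl n) ∂μ

/-- The rank-one operator `v ↦ ⟨ξ, v⟩ ξ`. -/
def rankOneOp {n : ℕ} (ξ : Eucl n) : Eucl n →L[ℝ] Eucl n :=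
  (innerSL ℝ ξ).smulRight ξ

/-- The operator `(p - 1) ∫ |⟨x, ξ⟩|^{p-2} ξ ⊗ ξ dμ(ξ)`, the derivative of `cosineField`. -/
def cosineHessian {n : ℕ} (p : ℝ) (μ : Measure (Sph n)) (x : Eucl n) : Eucl n →L[ℝ] Eucl n :=
  ∫ ξ : Sph n, ((p - 1) * |inner ℝ x (ξ : Eucl n)| ^ (p - 2)) • rankOneOp (ξ : Eucl n) ∂μ

theorem continuous_rankOneOp {n : ℕ} : Continuous (rankOneOp : Eucl n → _) := by
  unfold rankOneOp
  exact ((ContinuousLinearMap.smulRightL ℝ (Eucl n) (Eucl n)).continuous₂).comp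
    ((innerSL ℝ).continuous.prodMk continuous_id)

theorem norm_rankOneOp {n : ℕ} (ξ : Sph n) : ‖rankOneOp (ξ : Eucl n)‖ = 1 := by
  simp [rankOneOp]

theorem rankOneOp_apply {n : ℕ} (ξ v : Eucl n) : rankOneOp ξ v = inner ℝ ξ v • ξ := rfl

section Calculus

variable {n : ℕ} {p : ℝ} {μ : Measure (Sph n)} {C : ℝ≥0}

theorem isFiniteMeasure_of_le_sphereMeasure (hμ : μ ≤ C • sphereMeasure n) :
    IsFiniteMeasure μ := by
  have : IsFiniteMeasure (sphereMeasure n) := by unfold sphereMeasure; infer_instance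
  exact isFiniteMeasure_of_le _ hμ

theorem ae_of_le_sphereMeasure (hμ : μ ≤ C • sphereMeasure n) {P : Sph n → Prop}
    (h : ∀ᵐ ξ ∂(sphereMeasure n), P ξ) : ∀ᵐ ξ ∂μ, P ξ := by
  have h1 : μ ≪ sphereMeasure n := by
    refine (Measure.absolutelyContinuous_of_le hμ).trans ?_
    exact Measure.smul_absolutelyContinuous
  exact h1.ae_le h

theorem integrable_of_le_sphereMeasure (hμ : μ ≤ C • sphereMeasure n) {F : Type*}
    [NormedAddCommGroup F] {k : Sph n → F} (hk : Integrable k (sphereMeasure n)) :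
    Integrable k μ :=
  (hk.smul_measure_nnreal).mono_measure hμ

theorem integrable_inner_rpow_of_le (hμ : μ ≤ C • sphereMeasure n) {s : ℝ} (hs : -1 < s)
    {x : Eucl n} (hx : x ≠ 0) :
    Integrable (fun ξ : Sph n => |inner ℝ x (ξ : Eucl n)| ^ s) μ :=
  integrable_of_le_sphereMeasure hμ (integrable_inner_rpow hs hx)

theorem abs_oddPow_inner_le (hp : 1 < p) (x : Eucl n) (ξ : Sph n) :
    |oddPow p (inner ℝ x (ξ : Eucl n))| ≤ ‖x‖ ^ (p - 1) := by
  rw [abs_oddPow hp]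
  exact Real.rpow_le_rpow (abs_nonneg _) (inner_le_norm_sph x ξ) (by linarith)

theorem integrable_abs_inner_rpow [IsFiniteMeasure μ] {s : ℝ} (hs : 0 ≤ s) (x : Eucl n) :
    Integrable (fun ξ : Sph n => |inner ℝ x (ξ : Eucl n)| ^ s) μ := by
  refine Integrable.of_bound (by fun_prop : Measurable _).aestronglyMeasurable (‖x‖ ^ s)
    (ae_of_all _ fun ξ => ?_)
  rw [Real.norm_of_nonneg (by positivity)]
  exact Real.rpow_le_rpow (abs_nonneg _) (inner_le_norm_sph x ξ) hs

theorem integrable_cosineField [IsFiniteMeasure μ] (hp : 1 < p) (x : Eucl n) :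
    Integrable (fun ξ : Sph n => oddPow p (inner ℝ x (ξ : Eucl n)) • (ξ : Eucl n)) μ := by
  refine Integrable.of_bound (by fun_prop : Measurable _).aestronglyMeasurable (‖x‖ ^ (p - 1))
    (ae_of_all _ fun ξ => ?_)
  rw [norm_smul, norm_eq_of_mem_sphere, mul_one]
  exact abs_oddPow_inner_le hp x ξ


theorem hasFDerivAt_inner_const (ξ : Eucl n) (y : Eucl n) :
    HasFDerivAt (fun y : Eucl n => inner ℝ y ξ) (innerSL ℝ ξ) y := by
  simp_rw [real_inner_comm ξ]
  exact (innerSL ℝ ξ).hasFDerivAt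

theorem norm_le_add_one_of_mem_ball {x y : Eucl n} (hy : y ∈ Metric.ball x 1) : ‖y‖ ≤ ‖x‖ + 1 := by
  have h1 := norm_sub_norm_le y x
  have h2 : ‖y - x‖ < 1 := by simpa [dist_eq_norm] using hy
  linarith

theorem hasGradientAt_cosinePotential [IsFiniteMeasure μ] (hp : 1 < p) (x : Eucl n) :
    HasGradientAt (cosinePotential p μ) (p • cosineField p μ x) x := by
  have hdiff : ∀ (ξ : Sph n) (y : Eucl n), HasFDerivAt (fun y => |inner ℝ y (ξ : Eucl n)| ^ p)
      ((p * oddPow p (inner ℝ y (ξ : Eucl n))) • innerSL ℝ (ξ : Eucl n)) y := by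
    intro ξ y
    refine ((hasDerivAt_abs_rpow (inner ℝ y (ξ : Eucl n)) hp).comp_hasFDerivAt
      (f := fun y : Eucl n => inner ℝ y (ξ : Eucl n)) y
      (hasFDerivAt_inner_const (ξ : Eucl n) y)).congr_fderiv ?_
    rw [oddPow, mul_assoc]
  have hmeas : AEStronglyMeasurable (fun ξ : Sph n =>
      (p * oddPow p (inner ℝ x (ξ : Eucl n))) • innerSL ℝ (ξ : Eucl n)) μ :=
    ((by fun_prop : Measurable fun ξ : Sph n =>
      p * oddPow p (inner ℝ x (ξ : Eucl n)))).aestronglyMeasurable.smul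
      (by fun_prop : Continuous fun ξ : Sph n => innerSL ℝ (ξ : Eucl n)).aestronglyMeasurable
  have hbound : ∀ (ξ : Sph n) (y : Eucl n), y ∈ Metric.ball x 1 →
      ‖(p * oddPow p (inner ℝ y (ξ : Eucl n))) • innerSL ℝ (ξ : Eucl n)‖ ≤
        p * (‖x‖ + 1) ^ (p - 1) := by
    intro ξ y hy
    rw [norm_smul, innerSL_apply_norm, norm_eq_of_mem_sphere, mul_one, Real.norm_eq_abs, abs_mul,
      abs_of_pos (by linarith : 0 < p)]
    exact mul_le_mul_of_nonneg_left ((abs_oddPow_inner_le hp y ξ).trans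
      (Real.rpow_le_rpow (norm_nonneg y) (norm_le_add_one_of_mem_ball hy) (by linarith)))
      (by linarith)
  have h := hasFDerivAt_integral_of_dominated_of_fderiv_le (μ := μ) (x₀ := x)
    (F := fun y (ξ : Sph n) => |inner ℝ y (ξ : Eucl n)| ^ p)
    (F' := fun y (ξ : Sph n) => (p * oddPow p (inner ℝ y (ξ : Eucl n))) • innerSL ℝ (ξ : Eucl n))
    (bound := fun _ => p * (‖x‖ + 1) ^ (p - 1)) (s := Metric.ball x 1)
    (Metric.ball_mem_nhds x one_pos)
    (.of_forall fun y => (by fun_prop : Measurable _).aestronglyMeasurable)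
    (integrable_abs_inner_rpow (by linarith) x) hmeas
    (ae_of_all _ fun ξ y hy => hbound ξ y hy) (integrable_const _)
    (ae_of_all _ fun ξ y _ => hdiff ξ y)
  rw [hasGradientAt_iff_hasFDerivAt]
  refine h.congr_fderiv ?_
  ext v
  have hint : Integrable (fun ξ : Sph n =>
      (p * oddPow p (inner ℝ x (ξ : Eucl n))) • innerSL ℝ (ξ : Eucl n)) μ :=
    Integrable.of_bound hmeas (p * (‖x‖ + 1) ^ (p - 1))
      (ae_of_all _ fun ξ => hbound ξ x (Metric.mem_ball_self one_pos))
  rw [ContinuousLinearMap.integral_apply hint, InnerProductSpace.toDual_apply_apply,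
    real_inner_comm, inner_smul_right, cosineField, ← integral_inner (integrable_cosineField hp x),
    ← integral_const_mul]
  refine integral_congr_ae (ae_of_all _ fun ξ => ?_)
  simp only [smul_apply, innerSL_apply_apply, smul_eq_mul, inner_smul_right,
    real_inner_comm v]
  ring

theorem inner_cosineField [IsFiniteMeasure μ] (hp : 1 < p) (x v : Eucl n) :
    inner ℝ (cosineField p μ x) v =
      ∫ ξ : Sph n, oddPow p (inner ℝ x (ξ : Eucl n)) * inner ℝ v (ξ : Eucl n) ∂μ := by
  rw [real_inner_comm, cosineField, ← integral_inner (integrable_cosineField hp x)]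
  simp only [inner_smul_right]

theorem inner_cosineField_self [IsFiniteMeasure μ] (hp : 1 < p) (x : Eucl n) :
    inner ℝ (cosineField p μ x) x = cosinePotential p μ x := by
  rw [inner_cosineField hp, cosinePotential]
  simp only [oddPow_mul_self hp]

theorem aestronglyMeasurable_hessian (x : Eucl n) : AEStronglyMeasurable (fun ξ : Sph n =>
    ((p - 1) * |inner ℝ x (ξ : Eucl n)| ^ (p - 2)) • rankOneOp (ξ : Eucl n)) μ :=
  ((by fun_prop : Measurable fun ξ : Sph n =>
    (p - 1) * |inner ℝ x (ξ : Eucl n)| ^ (p - 2))).aestronglyMeasurable.smul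
    (continuous_rankOneOp.comp continuous_subtype_val).aestronglyMeasurable

theorem integrable_hessian (hμ : μ ≤ C • sphereMeasure n) (hp : 1 < p) {x : Eucl n}
    (hx : x ≠ 0) : Integrable (fun ξ : Sph n =>
    ((p - 1) * |inner ℝ x (ξ : Eucl n)| ^ (p - 2)) • rankOneOp (ξ : Eucl n)) μ := by
  refine ((integrable_inner_rpow_of_le hμ (by linarith : -1 < p - 2) hx).const_mul (p - 1)).mono
    (aestronglyMeasurable_hessian x) (ae_of_all _ fun ξ => ?_)
  rw [norm_smul, norm_rankOneOp, mul_one]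

/-- The cosine field of a measure with bounded density is differentiable away from the origin. The
singular kernel `|⟨x, ξ⟩|^{p-2}` itself dominates the difference quotients based at `x` when
`p < 2`. -/
theorem hasFDerivAt_cosineField (hμ : μ ≤ C • sphereMeasure n) (hp : 1 < p) {x : Eucl n}
    (hx : x ≠ 0) : HasFDerivAt (cosineField p μ) (cosineHessian p μ x) x := by
  have hfin := isFiniteMeasure_of_le_sphereMeasure hμ
  have hne : ∀ᵐ ξ : Sph n ∂μ, inner ℝ x (ξ : Eucl n) ≠ 0 :=
    ae_of_le_sphereMeasure hμ (ae_inner_ne_zero hx)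
  have hsub : ∀ (y : Eucl n) (ξ : Sph n),
      |inner ℝ y (ξ : Eucl n) - inner ℝ x (ξ : Eucl n)| ≤ ‖y - x‖ := by
    intro y ξ
    rw [← inner_sub_left]
    exact inner_le_norm_sph _ ξ
  obtain ⟨bound, hbound, hlip⟩ : ∃ bound : Sph n → ℝ, Integrable bound μ ∧
      ∀ᵐ ξ : Sph n ∂μ, ∀ y ∈ Metric.ball x 1,
        |oddPow p (inner ℝ y (ξ : Eucl n)) - oddPow p (inner ℝ x (ξ : Eucl n))| ≤
          bound ξ * ‖y - x‖ := by
    rcases lt_or_ge p 2 with hp2 | hp2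
    · refine ⟨fun ξ => 2 * |inner ℝ x (ξ : Eucl n)| ^ (p - 2),
        (integrable_inner_rpow_of_le hμ (by linarith) hx).const_mul 2, ?_⟩
      filter_upwards [hne] with ξ hξ y _
      refine (abs_oddPow_sub_le_of_lt_two hp hp2 hξ _).trans ?_
      exact mul_le_mul_of_nonneg_left (hsub y ξ) (by positivity)
    · refine ⟨fun ξ => (p - 1) * (‖x‖ + 1) ^ (p - 2), integrable_const _, ?_⟩
      refine ae_of_all _ fun ξ y hy => ?_
      refine (abs_oddPow_sub_le_of_two_le hp2 (R := ‖x‖ + 1) ?_ ?_).trans ?_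
      · exact (inner_le_norm_sph x ξ).trans (by linarith)
      · exact (inner_le_norm_sph y ξ).trans (norm_le_add_one_of_mem_ball hy)
      · exact mul_le_mul_of_nonneg_left (hsub y ξ)
          (mul_nonneg (by linarith) (by positivity))
  refine (hasFDerivAt_integral_of_dominated_loc_of_lip' (μ := μ) (x₀ := x)
    (F := fun y (ξ : Sph n) => oddPow p (inner ℝ y (ξ : Eucl n)) • (ξ : Eucl n))
    (F' := fun ξ : Sph n =>
      ((p - 1) * |inner ℝ x (ξ : Eucl n)| ^ (p - 2)) • rankOneOp (ξ : Eucl n))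
    (bound := bound) (Metric.ball_mem_nhds x one_pos)
    (fun y _ => (by fun_prop : Measurable _).aestronglyMeasurable)
    (integrable_cosineField hp x) (aestronglyMeasurable_hessian x) ?_ hbound ?_).2
  · filter_upwards [hlip] with ξ hξ y hy
    rw [← sub_smul, norm_smul, norm_eq_of_mem_sphere, mul_one]
    exact hξ y hy
  · filter_upwards [hne] with ξ hξ
    refine (((hasDerivAt_oddPow p hξ).comp_hasFDerivAt
      (f := fun y : Eucl n => inner ℝ y (ξ : Eucl n)) x
      (hasFDerivAt_inner_const (ξ : Eucl n) x)).smul_const (ξ : Eucl n)).congr_fderiv ?_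
    ext1 v
    simp [rankOneOp_apply, smul_smul]

theorem continuousAt_cosineHessian (hμ : μ ≤ C • sphereMeasure n) (hp : 1 < p) {x : Eucl n}
    (hx : x ≠ 0) : ContinuousAt (cosineHessian p μ) x := by
  rw [ContinuousAt, tendsto_iff_norm_sub_tendsto_zero]
  have hs : -1 < p - 2 := by linarith
  have h0 := (tendsto_integral_abs_inner_rpow_sub hs hx).const_mul ((p - 1) * C)
  rw [mul_zero] at h0
  refine squeeze_zero' (.of_forall fun y => norm_nonneg _) ?_ h0
  filter_upwards [isOpen_ne.mem_nhds hx] with y hy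
  rw [cosineHessian, cosineHessian,
    ← integral_sub (integrable_hessian hμ hp hy) (integrable_hessian hμ hp hx)]
  have hint : Integrable (fun ξ : Sph n =>
      |(|inner ℝ y (ξ : Eucl n)| ^ (p - 2) - |inner ℝ x (ξ : Eucl n)| ^ (p - 2))|)
      (sphereMeasure n) :=
    ((integrable_inner_rpow hs hy).sub (integrable_inner_rpow hs hx)).abs
  refine (norm_integral_le_integral_norm _).trans ?_
  calc ∫ ξ : Sph n, ‖((p - 1) * |inner ℝ y (ξ : Eucl n)| ^ (p - 2)) • rankOneOp (ξ : Eucl n) -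
        ((p - 1) * |inner ℝ x (ξ : Eucl n)| ^ (p - 2)) • rankOneOp (ξ : Eucl n)‖ ∂μ
      = (p - 1) * ∫ ξ : Sph n,
        |(|inner ℝ y (ξ : Eucl n)| ^ (p - 2) - |inner ℝ x (ξ : Eucl n)| ^ (p - 2))| ∂μ := by
        rw [← integral_const_mul]
        refine integral_congr_ae (ae_of_all _ fun ξ => ?_)
        simp only
        rw [← sub_smul (M := Eucl n →L[ℝ] Eucl n), norm_smul, norm_rankOneOp, mul_one, ← mul_sub,
          Real.norm_eq_abs, abs_mul,
          abs_of_pos (by linarith : 0 < p - 1)]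
    _ ≤ (p - 1) * ∫ ξ : Sph n,
        |(|inner ℝ y (ξ : Eucl n)| ^ (p - 2) - |inner ℝ x (ξ : Eucl n)| ^ (p - 2))|
          ∂(C • sphereMeasure n) := by
        refine mul_le_mul_of_nonneg_left ?_ (by linarith)
        exact integral_mono_measure hμ (ae_of_all _ fun ξ => abs_nonneg _)
          (hint.smul_measure_nnreal)
    _ = _ := by
        rw [integral_smul_nnreal_measure, NNReal.smul_def, smul_eq_mul, mul_assoc]

/-! ### Positivity of the second derivative -/

theorem integral_pos_of_ae_pos (hμ0 : μ ≠ 0) {k : Sph n → ℝ} (hk : Integrable k μ)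
    (hpos : ∀ᵐ ξ ∂μ, 0 < k ξ) : 0 < ∫ ξ, k ξ ∂μ := by
  have h0 : 0 ≤ᵐ[μ] k := hpos.mono fun ξ h => h.le
  refine lt_of_le_of_ne (integral_nonneg_of_ae h0) fun h => hμ0 ?_
  have h1 := (integral_eq_zero_iff_of_nonneg_ae h0 hk).1 h.symm
  rw [← ae_eq_bot, ← Filter.eventually_false_iff_eq_bot]
  filter_upwards [hpos, h1] with ξ h2 h3
  exact h2.ne' h3

theorem cosinePotential_pos (hμ : μ ≤ C • sphereMeasure n) (hμ0 : μ ≠ 0) (hp : 1 < p)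
    {x : Eucl n} (hx : x ≠ 0) : 0 < cosinePotential p μ x := by
  have hfin := isFiniteMeasure_of_le_sphereMeasure hμ
  refine integral_pos_of_ae_pos hμ0 (integrable_abs_inner_rpow (by linarith) x) ?_
  filter_upwards [ae_of_le_sphereMeasure hμ (ae_inner_ne_zero hx)] with ξ hξ
  have := abs_pos.2 hξ
  positivity

theorem integrable_rpow_mul_inner_sq (hμ : μ ≤ C • sphereMeasure n) (hp : 1 < p)
    {x : Eucl n} (hx : x ≠ 0) (v : Eucl n) :
    Integrable (fun ξ : Sph n =>
      |inner ℝ x (ξ : Eucl n)| ^ (p - 2) * inner ℝ v (ξ : Eucl n) ^ 2) μ := by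
  refine ((integrable_inner_rpow_of_le hμ (by linarith : -1 < p - 2) hx).mul_const (‖v‖ ^ 2)).mono
    (by fun_prop : Measurable _).aestronglyMeasurable (ae_of_all _ fun ξ => ?_)
  rw [norm_mul, norm_mul]
  refine mul_le_mul_of_nonneg_left ?_ (norm_nonneg _)
  rw [norm_pow, norm_pow, norm_norm]
  exact pow_le_pow_left₀ (norm_nonneg _) (inner_le_norm_sph v ξ) 2

theorem inner_cosineHessian_self (hμ : μ ≤ C • sphereMeasure n) (hp : 1 < p)
    {x : Eucl n} (hx : x ≠ 0) (v : Eucl n) :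
    inner ℝ (cosineHessian p μ x v) v = (p - 1) * ∫ ξ : Sph n,
      |inner ℝ x (ξ : Eucl n)| ^ (p - 2) * inner ℝ v (ξ : Eucl n) ^ 2 ∂μ := by
  have hint := integrable_hessian hμ hp hx
  rw [cosineHessian, ContinuousLinearMap.integral_apply hint, real_inner_comm,
    ← integral_inner (hint.apply_continuousLinearMap v), ← integral_const_mul]
  refine integral_congr_ae (ae_of_all _ fun ξ => ?_)
  simp only [smul_apply, rankOneOp_apply, inner_smul_right,
    real_inner_comm v]
  ring

/-- Strict Cauchy–Schwarz inequality between the weighted functions `⟨x, ξ⟩` and `⟨v, ξ⟩` for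
linearly independent `x` and `v`. -/
theorem inner_cosineField_sq_lt (hμ : μ ≤ C • sphereMeasure n) (hμ0 : μ ≠ 0) (hp : 1 < p)
    {x : Eucl n} (hx : x ≠ 0) {v : Eucl n} (hv : ∀ c : ℝ, v ≠ c • x) :
    (p - 1) * inner ℝ (cosineField p μ x) v ^ 2 <
      cosinePotential p μ x * inner ℝ (cosineHessian p μ x v) v := by
  have hfin := isFiniteMeasure_of_le_sphereMeasure hμ
  have hΦ := cosinePotential_pos hμ hμ0 hp hx
  set Φ := cosinePotential p μ x with hΦdef
  set G := inner ℝ (cosineField p μ x) v with hG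
  rw [inner_cosineHessian_self hμ hp hx]
  set Q := ∫ ξ : Sph n, |inner ℝ x (ξ : Eucl n)| ^ (p - 2) * inner ℝ v (ξ : Eucl n) ^ 2 ∂μ with hQ
  -- The minimum over `c` of the quadratic polynomial `∫ |⟨x, ξ⟩|^{p-2} ⟨v - c x, ξ⟩²`.
  let c : ℝ := G / Φ
  have hw : v - c • x ≠ 0 := sub_ne_zero.2 (hv c)
  have hpos : 0 < ∫ ξ : Sph n,
      |inner ℝ x (ξ : Eucl n)| ^ (p - 2) * inner ℝ (v - c • x) (ξ : Eucl n) ^ 2 ∂μ := by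
    refine integral_pos_of_ae_pos hμ0 (integrable_rpow_mul_inner_sq hμ hp hx _) ?_
    filter_upwards [ae_of_le_sphereMeasure hμ (ae_inner_ne_zero hx),
      ae_of_le_sphereMeasure hμ (ae_inner_ne_zero hw)] with ξ h1 h2
    have := abs_pos.2 h1
    positivity
  have hexp : ∫ ξ : Sph n,
      |inner ℝ x (ξ : Eucl n)| ^ (p - 2) * inner ℝ (v - c • x) (ξ : Eucl n) ^ 2 ∂μ =
      Q - 2 * c * G + c ^ 2 * Φ := by
    have i1 := integrable_rpow_mul_inner_sq hμ hp hx v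
    have i2 : Integrable (fun ξ : Sph n =>
        oddPow p (inner ℝ x (ξ : Eucl n)) * inner ℝ v (ξ : Eucl n)) μ := by
      have := (integrable_cosineField (μ := μ) hp x).const_inner (𝕜 := ℝ) v
      simpa only [inner_smul_right] using this
    have i3 := integrable_abs_inner_rpow (μ := μ) (by linarith : 0 ≤ p) x
    rw [hQ, hG, inner_cosineField hp, hΦdef, cosinePotential, ← integral_const_mul,
      ← integral_const_mul, ← integral_sub i1 (i2.const_mul _),
      ← integral_add (f := fun ξ : Sph n => |inner ℝ x (ξ : Eucl n)| ^ (p - 2) *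
        inner ℝ v (ξ : Eucl n) ^ 2 - 2 * c * (oddPow p (inner ℝ x (ξ : Eucl n)) *
        inner ℝ v (ξ : Eucl n))) (i1.sub (i2.const_mul _)) (i3.const_mul _)]
    refine integral_congr_ae (ae_of_all _ fun ξ => ?_)
    simp only
    rw [← oddPow_mul_self hp, oddPow, inner_sub_left, real_inner_smul_left]
    ring
  rw [hexp] at hpos
  have h1 : Q - 2 * c * G + c ^ 2 * Φ = Q - G ^ 2 / Φ := by
    simp only [c]; field_simp; ring
  rw [h1, sub_pos, div_lt_iff₀ hΦ] at hpos
  have := mul_lt_mul_of_pos_left hpos (by linarith : 0 < p - 1)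
  linarith

end Calculus

/-! ### Norms with positive definite tangential Hessian -/

/-- `H` is a norm on `ℝⁿ`, of class `C²` off the origin, with gradient field `N` and Hessian `D`
there, and the Hessian at `x` is positive definite transversally to the line through `x`. The
convexity of `H` is encoded by the supporting hyperplane inequality `inner_le`. -/
structure IsC2PlusNorm {n : ℕ} (H : Eucl n → ℝ) (N : Eucl n → Eucl n)
    (D : Eucl n → Eucl n →L[ℝ] Eucl n) : Prop where
  pos : ∀ {x}, x ≠ 0 → 0 < H x
  map_smul : ∀ (t : ℝ) x, H (t • x) = |t| * H x
  hasGradientAt : ∀ {x}, x ≠ 0 → HasGradientAt H (N x) x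
  inner_le : ∀ {x}, x ≠ 0 → ∀ z, inner ℝ (N x) z ≤ H z
  inner_self : ∀ {x}, x ≠ 0 → inner ℝ (N x) x = H x
  hasFDerivAt : ∀ {x}, x ≠ 0 → HasFDerivAt N (D x) x
  continuousAt : ∀ {x}, x ≠ 0 → ContinuousAt D x
  inner_pos : ∀ {x}, x ≠ 0 → ∀ {v}, (∀ c : ℝ, v ≠ c • x) → 0 < inner ℝ (D x v) v

section CosineNorm

variable {n : ℕ} {p : ℝ} {μ : Measure (Sph n)} {C : ℝ≥0}

theorem cosinePotential_smul (t : ℝ) (x : Eucl n) :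
    cosinePotential p μ (t • x) = |t| ^ p * cosinePotential p μ x := by
  rw [cosinePotential, cosinePotential, ← integral_const_mul]
  refine integral_congr_ae (ae_of_all _ fun ξ => ?_)
  simp only [real_inner_smul_left, abs_mul, Real.mul_rpow (abs_nonneg t) (abs_nonneg _)]

/-- Hölder's inequality for the cosine field. -/
theorem inner_cosineField_le [IsFiniteMeasure μ] (hp : 1 < p) (x z : Eucl n) :
    inner ℝ (cosineField p μ x) z ≤
      cosinePotential p μ x ^ (1 - p⁻¹) * cosinePotential p μ z ^ p⁻¹ := by
  have hpq := Real.HolderConjugate.conjExponent hp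
  set q := p.conjExponent
  have hmem : ∀ (r s : ℝ), 0 ≤ s → ∀ y : Eucl n,
      MemLp (fun ξ : Sph n => |inner ℝ y (ξ : Eucl n)| ^ s) (ENNReal.ofReal r) μ := by
    intro r s hs y
    refine MemLp.of_bound (by fun_prop : Measurable _).aestronglyMeasurable (‖y‖ ^ s)
      (ae_of_all _ fun ξ => ?_)
    rw [Real.norm_of_nonneg (by positivity)]
    exact Real.rpow_le_rpow (abs_nonneg _) (inner_le_norm_sph y ξ) hs
  have h := integral_mul_le_Lp_mul_Lq_of_nonneg (μ := μ) hpq.symm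
    (f := fun ξ : Sph n => |inner ℝ x (ξ : Eucl n)| ^ (p - 1))
    (g := fun ξ : Sph n => |inner ℝ z (ξ : Eucl n)| ^ (1 : ℝ))
    (ae_of_all _ fun ξ => by positivity) (ae_of_all _ fun ξ => by positivity)
    (hmem q (p - 1) (by linarith) x) (hmem p 1 zero_le_one z)
  have hq : (p - 1) * q = p := hpq.sub_one_mul_conj
  have hq' : 1 / q = 1 - p⁻¹ := by
    have := hpq.inv_add_inv_eq_one
    rw [one_div]; linarith
  simp only [← Real.rpow_mul (abs_nonneg _), hq, hq', one_div p, Real.rpow_one] at h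
  refine le_trans ?_ h
  rw [inner_cosineField hp]
  refine integral_mono ?_ ?_ fun ξ => ?_
  · have := (integrable_cosineField (μ := μ) hp x).const_inner (𝕜 := ℝ) z
    simpa only [inner_smul_right] using this
  · refine Integrable.of_bound (by fun_prop : Measurable _).aestronglyMeasurable
      (‖x‖ ^ (p - 1) * ‖z‖) (ae_of_all _ fun ξ => ?_)
    rw [Real.norm_of_nonneg (by positivity)]
    exact mul_le_mul (Real.rpow_le_rpow (abs_nonneg _) (inner_le_norm_sph x ξ) (by linarith))
      (inner_le_norm_sph z ξ) (abs_nonneg _) (by positivity)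
  · simp only
    rw [← abs_oddPow hp, ← abs_mul]
    exact le_abs_self _

/-- The `p`-th root of the `L^p`-cosine transform of a nonzero measure with bounded density is a
norm of class `C²` with positive definite tangential Hessian. -/
theorem isC2PlusNorm_cosinePotential_rpow (hμ : μ ≤ C • sphereMeasure n) (hμ0 : μ ≠ 0)
    (hp : 1 < p) : IsC2PlusNorm (fun x => cosinePotential p μ x ^ p⁻¹)
      (fun x => cosinePotential p μ x ^ (p⁻¹ - 1) • cosineField p μ x)
      (fun x => cosinePotential p μ x ^ (p⁻¹ - 1) • cosineHessian p μ x +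
        (((1 - p) * cosinePotential p μ x ^ (p⁻¹ - 1 - 1)) •
          innerSL ℝ (cosineField p μ x)).smulRight (cosineField p μ x)) := by
  have hfin := isFiniteMeasure_of_le_sphereMeasure hμ
  have hp0 : p ≠ 0 := by linarith
  have hΦ : ∀ {x : Eucl n}, x ≠ 0 → 0 < cosinePotential p μ x :=
    fun hx => cosinePotential_pos hμ hμ0 hp hx
  have hdΦ : ∀ x : Eucl n, HasFDerivAt (cosinePotential p μ)
      (innerSL ℝ (p • cosineField p μ x)) x := fun x =>
    (hasGradientAt_cosinePotential hp x).hasFDerivAt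
  refine ⟨fun {x} hx => ?_, fun t x => ?_, fun {x} hx => ?_, fun {x} hx z => ?_, fun {x} hx => ?_,
    fun {x} hx => ?_, fun {x} hx => ?_, fun {x} hx v hv => ?_⟩
  · have := hΦ hx
    positivity
  · have h0 : 0 ≤ cosinePotential p μ x := integral_nonneg fun ξ => by positivity
    rw [cosinePotential_smul, Real.mul_rpow (by positivity) h0,
      Real.rpow_rpow_inv (abs_nonneg t) hp0]
  · rw [hasGradientAt_iff_hasFDerivAt]
    refine ((hdΦ x).rpow_const (.inl (hΦ hx).ne')).congr_fderiv ?_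
    ext v
    simp only [smul_apply, innerSL_apply_apply, InnerProductSpace.toDual_apply_apply, smul_eq_mul,
      real_inner_smul_left]
    field_simp
  · simp only [real_inner_smul_left]
    have h1 := mul_le_mul_of_nonneg_left (inner_cosineField_le (μ := μ) hp x z)
      (Real.rpow_nonneg (hΦ hx).le (p⁻¹ - 1))
    rwa [← mul_assoc, ← Real.rpow_add (hΦ hx), sub_add_sub_cancel, sub_self, Real.rpow_zero,
      one_mul] at h1
  · simp only [real_inner_smul_left]
    rw [inner_cosineField_self hp, ← Real.rpow_add_one (hΦ hx).ne', sub_add_cancel]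
  · refine (((hdΦ x).rpow_const (.inl (hΦ hx).ne')).smul
      (hasFDerivAt_cosineField hμ hp hx)).congr_fderiv ?_
    congr 2
    ext v
    simp only [smul_apply, innerSL_apply_apply, smul_eq_mul, real_inner_smul_left]
    field_simp
  · have cΦ : ContinuousAt (cosinePotential p μ) x := (hdΦ x).continuousAt
    have cG : ContinuousAt (cosineField p μ) x := (hasFDerivAt_cosineField hμ hp hx).continuousAt
    have cr : ∀ a : ℝ, ContinuousAt (fun y => cosinePotential p μ y ^ a) x := fun a =>
      cΦ.rpow_const (.inl (hΦ hx).ne')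
    refine ((cr _).smul (continuousAt_cosineHessian hμ hp hx)).add ?_
    have c1 : ContinuousAt (fun y => ((1 - p) * cosinePotential p μ y ^ (p⁻¹ - 1 - 1)) •
        innerSL ℝ (cosineField p μ y)) x :=
      ((cr _).const_mul _).smul ((innerSL ℝ).continuous.continuousAt.comp cG)
    exact ((ContinuousLinearMap.smulRightL ℝ (Eucl n) (Eucl n)).continuous₂.continuousAt).comp
      (c1.prodMk cG)
  · have h1 := inner_cosineField_sq_lt hμ hμ0 hp hx hv
    have h2 : cosinePotential p μ x ^ (p⁻¹ - 1) =
        cosinePotential p μ x ^ (p⁻¹ - 1 - 1) * cosinePotential p μ x := by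
      rw [← Real.rpow_add_one (hΦ hx).ne', sub_add_cancel]
    simp only [add_apply, smul_apply, ContinuousLinearMap.smulRight_apply, innerSL_apply_apply,
      inner_add_left, real_inner_smul_left, smul_eq_mul]
    rw [h2]
    have h3 := mul_pos (Real.rpow_pos_of_pos (hΦ hx) (p⁻¹ - 1 - 1)) (sub_pos.2 h1)
    linarith [h3]

end CosineNorm

/-! ### Linear algebra of tangential compressions -/

/-- A linear endomorphism with positive definite (not necessarily symmetric) quadratic form has
positive determinant: it can be joined to the identity through such endomorphisms. -/
theorem det_pos_of_inner_pos {V : Type*} [NormedAddCommGroup V] [InnerProductSpace ℝ V]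
    [FiniteDimensional ℝ V] (T : V →ₗ[ℝ] V) (hT : ∀ v, v ≠ 0 → 0 < inner ℝ (T v) v) :
    0 < LinearMap.det T := by
  let P : ℝ → V →ₗ[ℝ] V := fun t => t • T + (1 - t) • LinearMap.id
  have hP : ∀ t ∈ Icc (0 : ℝ) 1, LinearMap.det (P t) ≠ 0 := by
    intro t ht h0
    obtain ⟨v, hv0, hv⟩ := Submodule.exists_mem_ne_zero_of_ne_bot
      (LinearMap.bot_lt_ker_of_det_eq_zero h0).ne'
    rw [LinearMap.mem_ker] at hv0
    have h1 : inner ℝ (P t v) v = t * inner ℝ (T v) v + (1 - t) * inner ℝ v v := by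
      simp [P, inner_add_left, real_inner_smul_left]
    rw [hv0, inner_zero_left] at h1
    have h2 := hT v hv
    have h3 : 0 < inner ℝ v v := real_inner_self_pos.2 hv
    rcases ht.1.eq_or_lt with h | h
    · subst h; linarith
    · nlinarith [mul_pos h h2, mul_nonneg (sub_nonneg.2 ht.2) h3.le]
  have hcont : Continuous fun t => LinearMap.det (P t) := by
    let b := Module.finBasis ℝ V
    simp_rw [← LinearMap.det_toMatrix b]
    refine Continuous.matrix_det ?_
    simp only [P, map_add, map_smul]
    fun_prop
  by_contra hneg
  have h1 : LinearMap.det (P 1) ≤ 0 := by simpa [P] using not_lt.1 hneg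
  have h0 : 0 ≤ LinearMap.det (P 0) := by simp [P]
  obtain ⟨t, ht, ht0⟩ := intermediate_value_Icc' zero_le_one hcont.continuousOn ⟨h1, h0⟩
  exact hP t ht ht0

section Geometry

variable {n : ℕ}

theorem inner_tangentCompression (u : Eucl n) (A : Eucl n →L[ℝ] Eucl n) (w : (ℝ ∙ u)ᗮ) :
    inner ℝ (tangentCompression u A w) w = inner ℝ (A w) (w : Eucl n) := by
  simp only [tangentCompression, ContinuousLinearMap.comp_apply, Submodule.subtypeL_apply]
  exact Submodule.inner_orthogonalProjectionOnto_eq_of_mem_right w _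

theorem det_tangentCompression_pos {u : Eucl n} {A : Eucl n →L[ℝ] Eucl n}
    (h : ∀ w, inner ℝ u w = 0 → w ≠ 0 → 0 < inner ℝ (A w) w) :
    0 < LinearMap.det (tangentCompression u A : (ℝ ∙ u)ᗮ →ₗ[ℝ] (ℝ ∙ u)ᗮ) := by
  refine det_pos_of_inner_pos _ fun w hw => ?_
  have := inner_tangentCompression u A w
  rw [ContinuousLinearMap.coe_coe, this]
  exact h w (Submodule.mem_orthogonal_singleton_iff_inner_right.1 w.2) (by simpa using hw)

theorem pos_of_hasEigenvalue_tangentCompression {u : Eucl n} {A : Eucl n →L[ℝ] Eucl n}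
    (h : ∀ w, inner ℝ u w = 0 → w ≠ 0 → 0 < inner ℝ (A w) w) {r : ℝ}
    (hr : Module.End.HasEigenvalue
      (tangentCompression u A : (ℝ ∙ u)ᗮ →ₗ[ℝ] (ℝ ∙ u)ᗮ) r) : 0 < r := by
  obtain ⟨w, hw⟩ := hr.exists_hasEigenvector
  have h1 := inner_tangentCompression u A w
  have h2 : tangentCompression u A w = r • w := hw.apply_eq_smul
  rw [h2, real_inner_smul_left] at h1
  have h3 := h w (Submodule.mem_orthogonal_singleton_iff_inner_right.1 w.2) (by simpa using hw.2)
  rw [← h1] at h3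
  exact pos_of_mul_pos_left h3 real_inner_self_nonneg

/-! ### The convex body of a norm -/

/-- A function whose gradient field is `C¹` is `C²`. -/
theorem contDiffAt_two_of_hasGradientAt {g : Eucl n → ℝ} {ψ : Eucl n → Eucl n} {x : Eucl n}
    (hg : ∀ᶠ y in 𝓝 x, HasGradientAt g (ψ y) y) (hψ : ContDiffAt ℝ 1 ψ x) :
    ContDiffAt ℝ 2 g x := by
  have h2 : (2 : WithTop ℕ∞) = ((1 : ℕ) : WithTop ℕ∞) + 1 := by norm_num
  rw [h2, contDiffAt_succ_iff_hasFDerivAt]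
  refine ⟨fun y => innerSL ℝ (ψ y), ⟨_, hg, fun y hy => hy.hasFDerivAt⟩, ?_⟩
  exact (innerSL ℝ : Eucl n →L[ℝ] _).contDiff.contDiffAt.comp x (by exact_mod_cast hψ)

namespace IsC2PlusNorm

variable {H : Eucl n → ℝ} {N : Eucl n → Eucl n} {D : Eucl n → Eucl n →L[ℝ] Eucl n}

theorem map_zero (S : IsC2PlusNorm H N D) : H 0 = 0 := by
  simpa using S.map_smul 0 0

theorem nonneg (S : IsC2PlusNorm H N D) (x : Eucl n) : 0 ≤ H x := by
  rcases eq_or_ne x 0 with rfl | hx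
  · exact S.map_zero.ge
  · exact (S.pos hx).le

theorem contDiffAt_field (S : IsC2PlusNorm H N D) {x : Eucl n} (hx : x ≠ 0) :
    ContDiffAt ℝ 1 N x := by
  rw [contDiffAt_one_iff]
  exact ⟨D, {0}ᶜ, isOpen_compl_singleton.mem_nhds hx,
    fun y hy => (S.continuousAt hy).continuousWithinAt, fun y hy => S.hasFDerivAt hy⟩

theorem contDiffAt (S : IsC2PlusNorm H N D) {x : Eucl n} (hx : x ≠ 0) : ContDiffAt ℝ 2 H x :=
  contDiffAt_two_of_hasGradientAt
    ((isOpen_ne.eventually_mem hx).mono fun _ hy => S.hasGradientAt hy)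
    (S.contDiffAt_field hx)

theorem continuousOn_sphere (S : IsC2PlusNorm H N D) :
    ContinuousOn H (Metric.sphere (0 : Eucl n) 1) := fun x hx =>
  (S.contDiffAt (ne_zero_of_mem_unit_sphere ⟨x, hx⟩)).continuousAt.continuousWithinAt

/-- The principal radii of curvature are positive. -/
theorem principalRadius_pos (S : IsC2PlusNorm H N D) {u : Eucl n} (hu : u ≠ 0) {r : ℝ}
    (hr : IsPrincipalRadius H u r) : 0 < r := by
  have h1 : gradient H =ᶠ[𝓝 u] N :=
    (isOpen_ne.eventually_mem hu).mono fun y hy => (S.hasGradientAt hy).gradient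
  have h2 : fderiv ℝ (gradient H) u = D u := by
    rw [h1.fderiv_eq, (S.hasFDerivAt hu).fderiv]
  unfold IsPrincipalRadius reverseWeingartenMap at hr
  rw [h2] at hr
  refine pos_of_hasEigenvalue_tangentCompression (fun w hw hw0 => S.inner_pos hu fun c hc => ?_) hr
  rw [hc, inner_smul_right, mul_eq_zero, inner_self_eq_zero] at hw
  rcases hw with rfl | h
  · exact hw0 (by rw [hc, zero_smul])
  · exact hu h

/-- To check that a point satisfies the inequalities defining the convex body with support
function `H`, it suffices to consider unit vectors. -/
theorem forall_inner_le_of_sphere (S : IsC2PlusNorm H N D) {y : Eucl n}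
    (h : ∀ z ∈ Metric.sphere (0 : Eucl n) 1, inner ℝ z y ≤ H z) (x : Eucl n) :
    inner ℝ x y ≤ H x := by
  rcases eq_or_ne x 0 with rfl | hx
  · simp [S.map_zero]
  have hx' := norm_pos_iff.2 hx
  have h1 := h (‖x‖⁻¹ • x) (by simp [norm_smul, hx])
  rw [S.map_smul, real_inner_smul_left, abs_of_pos (by positivity)] at h1
  exact le_of_mul_le_mul_left h1 (by positivity)

/-- The convex body with support function `H`. -/
def body (S : IsC2PlusNorm H N D) : ConvexBody (Eucl n) where
  carrier := {y | ∀ x, inner ℝ x y ≤ H x}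
  convex' := by
    intro y hy z hz a b ha hb hab x
    rw [inner_add_right, inner_smul_right, inner_smul_right]
    calc a * inner ℝ x y + b * inner ℝ x z ≤ a * H x + b * H x :=
          add_le_add (mul_le_mul_of_nonneg_left (hy x) ha) (mul_le_mul_of_nonneg_left (hz x) hb)
      _ = H x := by rw [← add_mul, hab, one_mul]
  isCompact' := by
    refine Metric.isCompact_of_isClosed_isBounded ?_ ?_
    · simp only [ofPred_forall]
      exact isClosed_iInter fun x => isClosed_le (by fun_prop) continuous_const
    · obtain ⟨M, hM⟩ := (isCompact_sphere (0 : Eucl n) 1).bddAbove_image S.continuousOn_sphere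
      refine isBounded_iff_forall_norm_le.2 ⟨max M 0, fun y hy => ?_⟩
      rcases eq_or_ne y 0 with rfl | hy0
      · simp
      have h1 : ‖y‖⁻¹ • y ∈ Metric.sphere (0 : Eucl n) 1 := by simp [norm_smul, hy0]
      have h2 := (hy (‖y‖⁻¹ • y)).trans (hM (mem_image_of_mem H h1))
      rw [real_inner_smul_left, real_inner_self_eq_norm_sq] at h2
      have h3 : ‖y‖⁻¹ * ‖y‖ ^ 2 = ‖y‖ := by
        have := norm_ne_zero_iff.2 hy0
        field_simp
      rw [h3] at h2
      exact h2.trans (le_max_left _ _)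
  nonempty' := ⟨0, fun x => by simpa using S.nonneg x⟩

theorem field_mem_body (S : IsC2PlusNorm H N D) {x : Eucl n} (hx : x ≠ 0) :
    N x ∈ (S.body : Set (Eucl n)) := fun z => by
  rw [real_inner_comm]; exact S.inner_le hx z

theorem isSupportFunction (S : IsC2PlusNorm H N D) : IsSupportFunction H S.body := by
  intro x
  refine IsGreatest.isLUB ⟨?_, ?_⟩
  · rcases eq_or_ne x 0 with rfl | hx
    · obtain ⟨y, hy⟩ := S.body.nonempty
      exact ⟨y, hy, by simp [S.map_zero]⟩
    · refine ⟨N x, S.field_mem_body hx, ?_⟩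
      simp only
      rw [real_inner_comm, S.inner_self hx]
  · rintro _ ⟨y, hy, rfl⟩
    exact hy x

theorem neg_mem_body (S : IsC2PlusNorm H N D) {y : Eucl n} (hy : y ∈ S.body) : -y ∈ S.body := by
  intro x
  have h1 := hy (-x)
  have h2 := S.map_smul (-1) x
  simp only [neg_smul, one_smul, abs_neg, abs_one, one_mul] at h2
  rwa [h2, inner_neg_left, ← inner_neg_right] at h1

/-- A point at which all the defining inequalities are strict on the sphere is interior. -/
theorem mem_interior_body (S : IsC2PlusNorm H N D) {x₀ : Eucl n}
    (h : ∀ z ∈ Metric.sphere (0 : Eucl n) 1, inner ℝ z x₀ < H z) :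
    x₀ ∈ interior (S.body : Set (Eucl n)) := by
  obtain ⟨ε, hε, hle⟩ := (isCompact_sphere (0 : Eucl n) 1).exists_forall_le'
    (f := fun z => H z - inner ℝ z x₀) (a := 0)
    (S.continuousOn_sphere.sub (by fun_prop)) (fun z hz => sub_pos.2 (h z hz))
  rw [mem_interior_iff_mem_nhds]
  refine mem_of_superset (Metric.ball_mem_nhds x₀ hε) fun y hy => ?_
  refine S.forall_inner_le_of_sphere fun z hz => ?_
  have h1 := hle z hz
  have h2 : inner ℝ z (y - x₀) ≤ ε := by
    refine (real_inner_le_norm _ _).trans ?_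
    rw [mem_sphere_zero_iff_norm.1 hz, one_mul, ← dist_eq_norm]
    exact (Metric.mem_ball.1 hy).le
  rw [inner_sub_right] at h2
  linarith

theorem interior_body_nonempty (S : IsC2PlusNorm H N D) :
    (interior (S.body : Set (Eucl n))).Nonempty :=
  ⟨0, S.mem_interior_body fun z hz => by
    rw [inner_zero_right]; exact S.pos (ne_zero_of_mem_unit_sphere ⟨z, hz⟩)⟩

/-- Every boundary point of the body is the gradient of `H` at some point with `H = 1`. -/
theorem exists_field_eq_of_mem_frontier (S : IsC2PlusNorm H N D) {x₀ : Eucl n}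
    (hx₀ : x₀ ∈ frontier (S.body : Set (Eucl n))) : ∃ z, z ≠ 0 ∧ H z = 1 ∧ N z = x₀ := by
  have hmem : x₀ ∈ (S.body : Set (Eucl n)) := S.body.isCompact.isClosed.frontier_subset hx₀
  obtain ⟨w, hw, hle⟩ : ∃ w ∈ Metric.sphere (0 : Eucl n) 1, H w ≤ inner ℝ w x₀ := by
    by_contra! hcon
    exact hx₀.2 (S.mem_interior_body hcon)
  have hw0 : w ≠ 0 := ne_zero_of_mem_unit_sphere ⟨w, hw⟩
  have hHw := S.pos hw0
  have heq : inner ℝ w x₀ = H w := le_antisymm (hmem w) hle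
  have hz0 : (H w)⁻¹ • w ≠ 0 := smul_ne_zero (inv_ne_zero hHw.ne') hw0
  have hz1 : H ((H w)⁻¹ • w) = 1 := by
    rw [S.map_smul, abs_of_pos (by positivity), inv_mul_cancel₀ hHw.ne']
  refine ⟨(H w)⁻¹ • w, hz0, hz1, ?_⟩
  set z := (H w)⁻¹ • w with hz
  -- The nonnegative function `H - ⟨·, x₀⟩` vanishes at `z`, hence so does its gradient.
  have hmin : IsLocalMin (fun y => H y - innerSL ℝ x₀ y) z := by
    refine .of_forall fun y => ?_
    have h1 : inner ℝ x₀ z = 1 := by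
      rw [real_inner_comm, hz, real_inner_smul_left, heq, inv_mul_cancel₀ hHw.ne']
    simp only [innerSL_apply_apply, h1, hz1, sub_self, sub_nonneg]
    rw [real_inner_comm]
    exact hmem y
  have hder := hmin.hasFDerivAt_eq_zero
    ((S.hasGradientAt hz0).hasFDerivAt.sub (innerSL ℝ x₀).hasFDerivAt)
  refine ext_inner_right ℝ fun v => ?_
  have := congrArg (fun L : Eucl n →L[ℝ] ℝ => L v) hder
  simpa [sub_eq_zero] using this

/-- The derivative of the map `z ↦ H z • N z`, the gradient of `H² / 2`. -/
def squareHessian (H : Eucl n → ℝ) (N : Eucl n → Eucl n) (D : Eucl n → Eucl n →L[ℝ] Eucl n)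
    (z : Eucl n) : Eucl n →L[ℝ] Eucl n :=
  H z • D z + (innerSL ℝ (N z)).smulRight (N z)

theorem hasFDerivAt_smul_field (S : IsC2PlusNorm H N D) {z : Eucl n} (hz : z ≠ 0) :
    HasFDerivAt (fun y => H y • N y) (squareHessian H N D z) z :=
  (S.hasGradientAt hz).hasFDerivAt.smul (S.hasFDerivAt hz)

/-- Differentiating the Euler relation `⟨N x, x⟩ = H x` shows that the Hessian of `H` takes values
orthogonal to `x`. -/
theorem inner_hessian_apply_self (S : IsC2PlusNorm H N D) {x : Eucl n} (hx : x ≠ 0) (v : Eucl n) :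
    inner ℝ (D x v) x = 0 := by
  have h1 : HasFDerivAt (fun y => inner ℝ (N y) y) _ x :=
    (S.hasFDerivAt hx).inner ℝ (hasFDerivAt_id x)
  have h2 : (fun y => inner ℝ (N y) y) =ᶠ[𝓝 x] H :=
    (isOpen_ne.eventually_mem hx).mono fun y hy => S.inner_self hy
  have h3 := (h1.congr_of_eventuallyEq h2.symm).unique (S.hasGradientAt hx).hasFDerivAt
  have h4 := congrArg (fun L : Eucl n →L[ℝ] ℝ => L v) h3
  simpa [fderivInnerCLM_apply] using h4

theorem inner_squareHessian_pos (S : IsC2PlusNorm H N D) {z : Eucl n} (hz : z ≠ 0) {v : Eucl n}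
    (hv : v ≠ 0) : 0 < inner ℝ (squareHessian H N D z v) v := by
  have h1 : inner ℝ (squareHessian H N D z v) v =
      H z * inner ℝ (D z v) v + inner ℝ (N z) v ^ 2 := by
    simp only [squareHessian, add_apply, smul_apply, ContinuousLinearMap.smulRight_apply,
      innerSL_apply_apply, inner_add_left, real_inner_smul_left]
    ring
  rw [h1]
  by_cases hc : ∃ c : ℝ, v = c • z
  · obtain ⟨c, rfl⟩ := hc
    have hc0 : c ≠ 0 := by rintro rfl; simp at hv
    rw [inner_smul_right, S.inner_hessian_apply_self hz, inner_smul_right, S.inner_self hz]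
    have := S.pos hz
    simp only [mul_zero, zero_add]
    positivity
  · push Not at hc
    have := mul_pos (S.pos hz) (S.inner_pos hz hc)
    positivity

/-- Near a boundary point, the Legendre transform of `H² / 2`, minus `1 / 2`, is a defining function
of the body; its gradient is the local inverse of the gradient of `H² / 2`. -/
theorem exists_isLocalDefiningFunction (S : IsC2PlusNorm H N D) {x₀ : Eucl n}
    (hx₀ : x₀ ∈ frontier (S.body : Set (Eucl n))) : ∃ g : Eucl n → ℝ,
      IsLocalDefiningFunction (S.body : Set (Eucl n)) g x₀ ∧ 0 < gaussKronecker g x₀ := by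
  obtain ⟨z₀, hz0, hHz, hNz⟩ := S.exists_field_eq_of_mem_frontier hx₀
  set M : Eucl n → Eucl n := fun y => H y • N y with hM
  have hMz : M z₀ = x₀ := by simp only [hM, hHz, hNz, one_smul]
  let A := squareHessian H N D z₀
  have hAinj : Function.Injective A := by
    refine (injective_iff_map_eq_zero A).2 fun v hv => ?_
    by_contra hv0
    have := S.inner_squareHessian_pos hz0 hv0
    change 0 < inner ℝ (A v) v at this
    rw [hv, inner_zero_left] at this
    exact lt_irrefl _ this
  let e : Eucl n ≃L[ℝ] Eucl n :=
    (LinearEquiv.ofInjectiveEndo (A : Eucl n →ₗ[ℝ] Eucl n) hAinj).toContinuousLinearEquiv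
  have he : (e : Eucl n →L[ℝ] Eucl n) = A := by ext1 v; rfl
  have hMc : ContDiffAt ℝ 1 M z₀ :=
    ((S.contDiffAt hz0).of_le (by norm_num)).smul (S.contDiffAt_field hz0)
  have hMd : HasFDerivAt M (e : Eucl n →L[ℝ] Eucl n) z₀ := by
    rw [he]; exact S.hasFDerivAt_smul_field hz0
  have hMs : HasStrictFDerivAt M (e : Eucl n →L[ℝ] Eucl n) z₀ :=
    hMc.hasStrictFDerivAt' hMd one_ne_zero
  let ψ : Eucl n → Eucl n := hMs.localInverse M e z₀
  have hψx : ψ x₀ = z₀ := by rw [← hMz]; exact hMs.localInverse_apply_image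
  have hψc : ContDiffAt ℝ 1 ψ x₀ := by
    rw [← hMz]; exact hMc.to_localInverse hMd one_ne_zero
  have hψd : HasFDerivAt ψ (e.symm : Eucl n →L[ℝ] Eucl n) x₀ := by
    rw [← hMz]; exact hMs.to_localInverse.hasFDerivAt
  have hinv : ∀ᶠ y in 𝓝 x₀, M (ψ y) = y := by
    rw [← hMz]; exact hMs.eventually_right_inverse
  have hψ0 : ∀ᶠ y in 𝓝 x₀, ψ y ≠ 0 := by
    refine hψc.continuousAt.eventually_ne ?_
    rwa [hψx]
  have hψdiff : ∀ᶠ y in 𝓝 x₀, DifferentiableAt ℝ ψ y :=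
    (hψc.eventually (by simp)).mono fun y hy => hy.differentiableAt one_ne_zero
  have hin : ∀ y, M (ψ y) = y → ∀ v, inner ℝ y v = H (ψ y) * inner ℝ (N (ψ y)) v := by
    intro y hy v
    rw [← real_inner_smul_left]
    exact congrArg (fun w => inner ℝ w v) hy.symm
  let g : Eucl n → ℝ := fun y => inner ℝ y (ψ y) - H (ψ y) ^ 2 / 2 - 1 / 2
  have hgrad : ∀ᶠ y in 𝓝 x₀, HasGradientAt g (ψ y) y := by
    filter_upwards [hinv, hψ0, hψdiff] with y h1 h2 h3
    rw [hasGradientAt_iff_hasFDerivAt]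
    have h4 := (((hasFDerivAt_id y).inner ℝ h3.hasFDerivAt).sub
      ((((S.hasGradientAt h2).hasFDerivAt.comp y h3.hasFDerivAt).pow 2).mul_const
        (1 / 2 : ℝ))).sub_const (1 / 2 : ℝ)
    have h5 : HasFDerivAt g _ y := h4.congr_of_eventuallyEq (.of_forall fun w => by
      simp only [g, Function.comp_apply, id, Pi.sub_apply]; ring)
    refine h5.congr_fderiv ?_
    ext v
    have h6 := hin y h1 (fderiv ℝ ψ y v)
    have h7 : inner ℝ v (ψ y) = inner ℝ (ψ y) v := real_inner_comm _ _
    simp [fderivInnerCLM_apply, h6, h7]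
    ring
  have hmem : ∀ᶠ y in 𝓝 x₀, y ∈ (S.body : Set (Eucl n)) ↔ g y ≤ 0 := by
    filter_upwards [hinv, hψ0] with y h1 h2
    have h3 : inner ℝ (ψ y) y = H (ψ y) ^ 2 := by
      rw [real_inner_comm, hin y h1, S.inner_self h2, sq]
    have hpos := S.pos h2
    have h4 : g y = (H (ψ y) ^ 2 - 1) / 2 := by
      simp only [g]
      rw [real_inner_comm, h3]; ring
    rw [h4]
    constructor
    · intro hy
      have h5 := hy (ψ y)
      rw [h3] at h5
      have h6 : H (ψ y) ≤ 1 := by nlinarith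
      nlinarith
    · intro hy w
      have h6 : H (ψ y) ≤ 1 := by nlinarith
      rw [real_inner_comm, hin y h1, real_inner_comm]
      calc H (ψ y) * inner ℝ w (N (ψ y)) ≤ H (ψ y) * H w :=
            mul_le_mul_of_nonneg_left (S.field_mem_body h2 w) hpos.le
        _ ≤ H w := mul_le_of_le_one_left (S.nonneg w) h6
  have hgx : gradient g x₀ = z₀ := by rw [hgrad.self_of_nhds.gradient, hψx]
  refine ⟨g, ⟨contDiffAt_two_of_hasGradientAt hgrad hψc, by rwa [hgx], hmem⟩, ?_⟩
  have hunit : unitNormal g =ᶠ[𝓝 x₀] fun y => ‖ψ y‖⁻¹ • ψ y := by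
    filter_upwards [hgrad] with y hy
    rw [unitNormal, hy.gradient]
  have hz0' := norm_pos_iff.2 hz0
  have hnd : DifferentiableAt ℝ (fun y => ‖ψ y‖⁻¹) x₀ := by
    have h1 : ψ x₀ ≠ 0 := by rwa [hψx]
    exact (hψd.differentiableAt.norm ℝ h1).inv (norm_ne_zero_iff.2 h1)
  have hud := (hnd.hasFDerivAt.smul hψd).congr_of_eventuallyEq hunit
  refine det_tangentCompression_pos fun w hw hw0 => ?_
  have hux : unitNormal g x₀ = ‖z₀‖⁻¹ • z₀ := by rw [unitNormal, hgx]
  rw [hux, real_inner_smul_left] at hw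
  have hw' : inner ℝ z₀ w = 0 := (mul_eq_zero.1 hw).resolve_left (by positivity)
  have hpos := S.inner_squareHessian_pos hz0 (v := e.symm w) (by simpa using hw0)
  have hAe : squareHessian H N D z₀ (e.symm w) = w := e.apply_symm_apply w
  rw [hAe, real_inner_comm] at hpos
  rw [hud.fderiv]
  simp only [add_apply, smul_apply, ContinuousLinearMap.smulRight_apply, inner_add_left,
    real_inner_smul_left, hψx, hw', mul_zero, add_zero]
  exact mul_pos (by positivity) hpos

theorem isC2Plus_body (S : IsC2PlusNorm H N D) : IsC2Plus S.body :=
  ⟨S.interior_body_nonempty, fun _ hx => S.exists_isLocalDefiningFunction hx⟩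

end IsC2PlusNorm

end Geometry

/-! ### Measures with a bounded density -/

/-- A bounded nonnegative density turns the cosine transform of a function into that of a measure
dominated by a multiple of the spherical measure. -/
theorem exists_measure_cosinePotential_eq {n : ℕ} {f : Sph n → ℝ}
    (hf : MemLp f ⊤ (sphereMeasure n)) (hf_nonneg : ∀ᵐ ξ ∂(sphereMeasure n), 0 ≤ f ξ)
    (hf_ne : ¬ (∀ᵐ ξ ∂(sphereMeasure n), f ξ = 0)) :
    ∃ (μ : Measure (Sph n)) (C : ℝ≥0), μ ≤ C • sphereMeasure n ∧ μ ≠ 0 ∧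
      ∀ (p : ℝ) (x : Eucl n), cosinePotential p μ x = cosineTransform p f x := by
  have hmeas : AEMeasurable (fun ξ => (f ξ).toNNReal) (sphereMeasure n) :=
    hf.1.aemeasurable.real_toNNReal
  refine ⟨(sphereMeasure n).withDensity fun ξ => ((f ξ).toNNReal : ENNReal),
    (eLpNorm f ⊤ (sphereMeasure n)).toNNReal, ?_, ?_, fun p x => ?_⟩
  · have h1 : ∀ᵐ ξ ∂(sphereMeasure n), ((f ξ).toNNReal : ENNReal) ≤
        ((eLpNorm f ⊤ (sphereMeasure n)).toNNReal : ENNReal) := by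
      rw [ENNReal.coe_toNNReal hf.2.ne, eLpNorm_exponent_top]
      filter_upwards [enorm_ae_le_eLpNormEssSup f (sphereMeasure n), hf_nonneg] with ξ h1 h2
      rwa [Real.enorm_of_nonneg h2] at h1
    refine (withDensity_mono h1).trans ?_
    rw [withDensity_const]
    rfl
  · rw [Ne, withDensity_eq_zero_iff hmeas.coe_nnreal_ennreal]
    intro h
    refine hf_ne ?_
    filter_upwards [h, hf_nonneg] with ξ h1 h2
    have h3 : f ξ ≤ 0 := by simpa using h1
    exact le_antisymm h3 h2
  · rw [cosinePotential, integral_withDensity_eq_integral_smul₀ hmeas, cosineTransform]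
    refine integral_congr_ae ?_
    filter_upwards [hf_nonneg] with ξ h
    rw [NNReal.smul_def, Real.coe_toNNReal _ h, smul_eq_mul, mul_comm]

end LpCosine

end

theorem theorem3p1 (n : ℕ) (hn : 2 ≤ n) (p : ℝ) (hp : 1 < p) (hpe : ∀ k : ℤ, p ≠ 2 * (k : ℝ))
    (f : LpCosine.Sph n → ℝ) (hf : MemLp f ⊤ (LpCosine.sphereMeasure n))
    (hf_nonneg : ∀ᵐ ξ ∂(LpCosine.sphereMeasure n), 0 ≤ f ξ)
    (hf_ne : ¬ (∀ᵐ ξ ∂(LpCosine.sphereMeasure n), f ξ = 0))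
    (H : LpCosine.Eucl n → ℝ) (hH_nonneg : ∀ x, 0 ≤ H x)
    (hH : ∀ x, H x ^ p = LpCosine.cosineTransform p f x) :
    ∃ K : ConvexBody (LpCosine.Eucl n),
      (∀ y ∈ K, -y ∈ K) ∧
      LpCosine.IsSupportFunction H K ∧
      LpCosine.IsC2Plus K ∧
      ContDiffOn ℝ 2 H {0}ᶜ ∧
      (∀ u : LpCosine.Eucl n, ‖u‖ = 1 → ∀ r : ℝ, LpCosine.IsPrincipalRadius H u r → 0 < r) := by
  obtain ⟨μ, C, hμ, hμ0, hμf⟩ := LpCosine.exists_measure_cosinePotential_eq hf hf_nonneg hf_ne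
  have hHμ : H = fun x => LpCosine.cosinePotential p μ x ^ p⁻¹ := by
    ext x
    rw [hμf, ← hH, Real.rpow_rpow_inv (hH_nonneg x) (by linarith)]
  have S := LpCosine.isC2PlusNorm_cosinePotential_rpow hμ hμ0 hp
  rw [← hHμ] at S
  exact ⟨S.body, fun y hy => S.neg_mem_body hy, S.isSupportFunction, S.isC2Plus_body,
    fun x hx => (S.contDiffAt hx).contDiffWithinAt,
    fun u hu r hr => S.principalRadius_pos (by rintro rfl; simp at hu) hr⟩
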